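/- Let $k$ be a field of characteristic $0$ and $K=k[[h]]$. All tensor products are over $K$. A *topological Hopf algebra* over $K$ is here a $K$-algebra $A_h$ with a two-sided ideal $J\ni h$ such that $A_h$ is separated and complete for the $J$-adic topology, together with a $K$-algebra morphism $\Delta:A_h\to A_h\widehat\otimes A_h=\varprojlim_n (A_h\otimes A_h)/(J\otimes A_h+A_h\otimes J)^n$ carrying $J$ into the kernel of $A_h\widehat\otimes A_h\to A_h/J\otimes A_h/J$, a $K$-algebra morphism $\epsilon:A_h\to K$ and a $K$-linear map $S_h:A_h\to A_h$ with $S_h(J^n)\subset J^n$ for all $n$, satisfying the Hopf algebra axioms in the completed tensor powers. (For $J=hA_h$ this is the usual notion with $h$-adically completed tensor products, and the conditions on $J$ hold automatically for $\Delta$ and $S_h$; quantum formal series Hopf algebras correspond to $J=\epsilon^{-1}(hK)$.) Let $A_0$ be a left noetherian $k$-algebra and $A_h$ a topological Hopf algebra over $K$ which is a deformation of $A_0$: $A_h\simeq A_0[[h]]$ as a $K$-module and $A_h/hA_h\simeq A_0$ as algebras. Let $A_h$ act on $K$ through $\epsilon$ and $A_0$ on $k$ through the reduction $\epsilon_0:A_0\to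 k$ of $\epsilon$ modulo $h$. Assume that there is an integer $d\ge 0$ such that $\mathrm{Ext}^i_{A_0}(k,A_0)=0$ for $i\ne d$ and $\mathrm{Ext}^d_{A_0}(k,A_0)\simeq k$ as $k$-vector spaces. Put $\Omega_{A_h}=\mathrm{Ext}^d_{A_h}(K,A_h)$, a right $A_h$-module through right multiplication on $A_h$. Let $V$ be a left $A_h$-module that is free of finite type over $K$, and let $V^*=\mathrm{Hom}_K(V,K)$ be the right $A_h$-module with $(f\cdot a)(v)=f(av)$. Then: 1. $\Omega_{A_h}$ is a free $K$-module of rank one, on which $A_h$ acts on the right through a character $\theta_{A_h}:A_h\to K$. 2. There is a unique right $A_h$-module structure on $\Omega_{A_h}\otimes V^*$, extending its $K$-module structure, such that for all $u\in A_h$, $\omega\in\Omega_{A_h}$, $f\in V^*$, $$(\omega\otimes f)\cdot u=\lim_{n\to\infty}\sum_j \theta_{A_h}(u'_{j,n})\,\omega\otimes f\cdot S_h^2(u''_{j,n})$$ ($h$-adic limit) whenever $t_n=\sum_j u'_{j,n}\otimes u''_{j,n}\in A_h\otimes A_h$ is congruent to $\Delta(u)$ modulo $(J\otimes A_h+A_h\otimes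 J)^n$ for every $n$. 3. With this structure, $D_{A_h}(V)=R\mathrm{Hom}_{A_h}(V,A_h)$ and $(V^*\otimes\Omega_{A_h})[-d]$ (the module $V^*\otimes\Omega_{A_h}$ placed in cohomological degree $d$) are isomorphic in the derived category $D(A_h^{op})$ of right $A_h$-modules. -/

import Mathlib

open CategoryTheory TensorProduct PowerSeries MulOpposite
open scoped ModuleCat

universe u w

/-! ### Adic completions and completed tensor products -/

section Completion

/-- The completion `lim B / I ^ n` of a (not necessarily commutative) `K`-algebra `B` along a
two-sided ideal `I`: compatible sequences of elements of the quotients `B / I ^ n`. -/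
def adicCompl (K : Type*) {B : Type*} [CommRing K] [Ring B] [Algebra K B]
    (I : Ideal B) [I.IsTwoSided] : Subalgebra K ((n : ℕ) → B ⧸ I ^ n) where
  carrier := {x | ∀ n : ℕ,
    Ideal.Quotient.factorₐ K (Ideal.pow_le_pow_right n.le_succ) (x (n + 1)) = x n}
  mul_mem' := by
    intro a b ha hb n
    rw [Pi.mul_apply, Pi.mul_apply, map_mul, ha n, hb n]
  add_mem' := by
    intro a b ha hb n
    rw [Pi.add_apply, Pi.add_apply, map_add, ha n, hb n]
  algebraMap_mem' := by
    intro r n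
    rw [Pi.algebraMap_apply, Pi.algebraMap_apply, AlgHom.commutes]

/-- `x ≡ z` modulo `I ^ n`, for an element `x` of `B` and an element `z` of the completion. -/
def ApproxAt {K B : Type*} [CommRing K] [Ring B] [Algebra K B] {I : Ideal B} [I.IsTwoSided]
    (n : ℕ) (x : B) (z : adicCompl K I) : Prop :=
  Ideal.Quotient.mk (I ^ n) x = (z : (n : ℕ) → B ⧸ I ^ n) n

/-- `B` is separated and complete for the `I`-adic topology, `I` a two-sided ideal. -/
structure IsIdealAdicComplete {B : Type*} [Ring B] (I : Ideal B) : Prop where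
  separated : ∀ a : B, (∀ n : ℕ, a ∈ I ^ n) → a = 0
  complete : ∀ f : ℕ → B, (∀ n, f (n + 1) - f n ∈ I ^ n) → ∃ a : B, ∀ n, f n - a ∈ I ^ n

variable (K : Type*) {A : Type*} [CommRing K] [Ring A] [Algebra K A]
variable (J : Ideal A) [J.IsTwoSided]

/-- The ideal `J ⊗ A + A ⊗ J` of `A ⊗ A`, as the kernel of `A ⊗ A → A/J ⊗ A/J`. -/
def tensorIdeal₂ : Ideal (A ⊗[K] A) :=
  RingHom.ker (Algebra.TensorProduct.map (Ideal.Quotient.mkₐ K J) (Ideal.Quotient.mkₐ K J))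

/-- The ideal `J ⊗ A ⊗ A + A ⊗ J ⊗ A + A ⊗ A ⊗ J` of `A ⊗ A ⊗ A`. -/
def tensorIdeal₃ : Ideal (A ⊗[K] (A ⊗[K] A)) :=
  RingHom.ker (Algebra.TensorProduct.map (Ideal.Quotient.mkₐ K J)
    (Algebra.TensorProduct.map (Ideal.Quotient.mkₐ K J) (Ideal.Quotient.mkₐ K J)))

instance : (tensorIdeal₂ K J).IsTwoSided := by unfold tensorIdeal₂; infer_instance

instance : (tensorIdeal₃ K J).IsTwoSided := by unfold tensorIdeal₃; infer_instance

/-- The completed tensor product `A ⊗̂ A`. For `J = h A` it is the `h`-adic completion of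
`A ⊗ A`. -/
abbrev CTensor : Subalgebra K ((n : ℕ) → (A ⊗[K] A) ⧸ tensorIdeal₂ K J ^ n) :=
  adicCompl K (tensorIdeal₂ K J)

/-- `x ⊗ y ↦ x ⊗ y ⊗ 1`. -/
def inc₁₂ (K A : Type*) [CommRing K] [Ring A] [Algebra K A] :
    A ⊗[K] A →ₐ[K] A ⊗[K] (A ⊗[K] A) :=
  Algebra.TensorProduct.map (AlgHom.id K A) Algebra.TensorProduct.includeLeft

/-- `x ⊗ y ↦ 1 ⊗ x ⊗ y`. -/
def inc₂₃ (K A : Type*) [CommRing K] [Ring A] [Algebra K A] :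
    A ⊗[K] A →ₐ[K] A ⊗[K] (A ⊗[K] A) :=
  Algebra.TensorProduct.includeRight

/-- `x ↦ x ⊗ 1 ⊗ 1`. -/
def inc₁ (K A : Type*) [CommRing K] [Ring A] [Algebra K A] : A →ₐ[K] A ⊗[K] (A ⊗[K] A) :=
  Algebra.TensorProduct.includeLeft

/-- `x ↦ 1 ⊗ 1 ⊗ x`. -/
def inc₃ (K A : Type*) [CommRing K] [Ring A] [Algebra K A] : A →ₐ[K] A ⊗[K] (A ⊗[K] A) :=
  (Algebra.TensorProduct.includeRight (R := K) (A := A) (B := A ⊗[K] A)).comp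
    Algebra.TensorProduct.includeRight

theorem inc₁₂_mem (x : A ⊗[K] A) (hx : x ∈ tensorIdeal₂ K J) :
    inc₁₂ K A x ∈ tensorIdeal₃ K J := by
  have key : (Algebra.TensorProduct.map (Ideal.Quotient.mkₐ K J)
      (Algebra.TensorProduct.map (Ideal.Quotient.mkₐ K J) (Ideal.Quotient.mkₐ K J))).comp
        (inc₁₂ K A) = (inc₁₂ K (A ⧸ J)).comp
      (Algebra.TensorProduct.map (Ideal.Quotient.mkₐ K J) (Ideal.Quotient.mkₐ K J)) := by
    ext a <;> simp [inc₁₂]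
  have h := DFunLike.congr_fun key x
  have hx' : Algebra.TensorProduct.map (Ideal.Quotient.mkₐ K J) (Ideal.Quotient.mkₐ K J) x = 0 := hx
  rw [AlgHom.comp_apply, AlgHom.comp_apply, hx', map_zero] at h
  exact h

theorem inc₂₃_mem (x : A ⊗[K] A) (hx : x ∈ tensorIdeal₂ K J) :
    inc₂₃ K A x ∈ tensorIdeal₃ K J := by
  have key : (Algebra.TensorProduct.map (Ideal.Quotient.mkₐ K J)
      (Algebra.TensorProduct.map (Ideal.Quotient.mkₐ K J) (Ideal.Quotient.mkₐ K J))).comp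
        (inc₂₃ K A) = (inc₂₃ K (A ⧸ J)).comp
      (Algebra.TensorProduct.map (Ideal.Quotient.mkₐ K J) (Ideal.Quotient.mkₐ K J)) := by
    ext a <;> rfl
  have h := DFunLike.congr_fun key x
  have hx' : Algebra.TensorProduct.map (Ideal.Quotient.mkₐ K J) (Ideal.Quotient.mkₐ K J) x = 0 := hx
  rw [AlgHom.comp_apply, AlgHom.comp_apply, hx', map_zero] at h
  exact h

theorem pow_mem_of_map_mem {B C : Type*} [Ring B] [Ring C] (f : B →+* C) (I : Ideal B)
    (I' : Ideal C) (h : ∀ x ∈ I, f x ∈ I') (n : ℕ) : ∀ x ∈ I ^ n, f x ∈ I' ^ n := by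
  induction n with
  | zero => intro x _; rw [Submodule.pow_zero, Ideal.one_eq_top]; trivial
  | succ n ih =>
    intro x hx
    rw [Submodule.pow_succ] at hx ⊢
    induction hx using Submodule.smul_induction_on' with
    | smul r hr m hm =>
      rw [smul_eq_mul, map_mul]
      exact Ideal.mul_mem_mul (ih r hr) (h m hm)
    | add x _ y _ hx hy => rw [map_add]; exact add_mem hx hy

/-- The map `A ⊗ A / (J ⊗ A + A ⊗ J) ^ n → A ⊗ A ⊗ A / (…) ^ n` induced by
`x ⊗ y ↦ x ⊗ y ⊗ 1`. -/
def inc₁₂Quot (n : ℕ) :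
    (A ⊗[K] A) ⧸ tensorIdeal₂ K J ^ n →ₐ[K] (A ⊗[K] (A ⊗[K] A)) ⧸ tensorIdeal₃ K J ^ n :=
  Ideal.Quotient.liftₐ (tensorIdeal₂ K J ^ n)
    ((Ideal.Quotient.mkₐ K (tensorIdeal₃ K J ^ n)).comp (inc₁₂ K A)) fun x hx =>
      Ideal.Quotient.eq_zero_iff_mem.2
        (pow_mem_of_map_mem (inc₁₂ K A).toRingHom _ _ (inc₁₂_mem K J) n x hx)

/-- The map `A ⊗ A / (J ⊗ A + A ⊗ J) ^ n → A ⊗ A ⊗ A / (…) ^ n` induced by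
`x ⊗ y ↦ 1 ⊗ x ⊗ y`. -/
def inc₂₃Quot (n : ℕ) :
    (A ⊗[K] A) ⧸ tensorIdeal₂ K J ^ n →ₐ[K] (A ⊗[K] (A ⊗[K] A)) ⧸ tensorIdeal₃ K J ^ n :=
  Ideal.Quotient.liftₐ (tensorIdeal₂ K J ^ n)
    ((Ideal.Quotient.mkₐ K (tensorIdeal₃ K J ^ n)).comp (inc₂₃ K A)) fun x hx =>
      Ideal.Quotient.eq_zero_iff_mem.2
        (pow_mem_of_map_mem (inc₂₃ K A).toRingHom _ _ (inc₂₃_mem K J) n x hx)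

variable {K} {J}

/-- `Δ ⊗ id` on `A ⊗ A`, with values in the `n`-th stage of the triple completed tensor product:
`x ⊗ y ↦ Δ x ⊗ y`. -/
noncomputable def comulLeft (Δ : A →ₐ[K] CTensor K J) (n : ℕ) :
    A ⊗[K] A →ₗ[K] (A ⊗[K] (A ⊗[K] A)) ⧸ tensorIdeal₃ K J ^ n :=
  TensorProduct.lift ((LinearMap.mul K ((A ⊗[K] (A ⊗[K] A)) ⧸ tensorIdeal₃ K J ^ n)).compl₁₂
    ((inc₁₂Quot K J n).comp
      ((Pi.evalAlgHom K (fun n : ℕ => (A ⊗[K] A) ⧸ tensorIdeal₂ K J ^ n) n).comp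
        ((CTensor K J).val.comp Δ))).toLinearMap
    ((Ideal.Quotient.mkₐ K (tensorIdeal₃ K J ^ n)).comp (inc₃ K A)).toLinearMap)

/-- `id ⊗ Δ` on `A ⊗ A`, with values in the `n`-th stage of the triple completed tensor product:
`x ⊗ y ↦ x ⊗ Δ y`. -/
noncomputable def comulRight (Δ : A →ₐ[K] CTensor K J) (n : ℕ) :
    A ⊗[K] A →ₗ[K] (A ⊗[K] (A ⊗[K] A)) ⧸ tensorIdeal₃ K J ^ n :=
  TensorProduct.lift ((LinearMap.mul K ((A ⊗[K] (A ⊗[K] A)) ⧸ tensorIdeal₃ K J ^ n)).compl₁₂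
    ((Ideal.Quotient.mkₐ K (tensorIdeal₃ K J ^ n)).comp (inc₁ K A)).toLinearMap
    ((inc₂₃Quot K J n).comp
      ((Pi.evalAlgHom K (fun n : ℕ => (A ⊗[K] A) ⧸ tensorIdeal₂ K J ^ n) n).comp
        ((CTensor K J).val.comp Δ))).toLinearMap)

end Completion

/-! ### Topological Hopf algebras over `k[[h]]` and deformations -/

/-- A topological Hopf algebra structure over `K = k[[h]]` on a `K`-algebra `A`.

The topology is the `J`-adic one for a two-sided ideal `J ∋ h`, and `A` is complete for it.
(`J = h A` is the usual `h`-adic case, in which all the continuity clauses are automatic;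
quantum formal series Hopf algebras, whose tensor products are completed further, are the case
`J = ε⁻¹(h K)`.)

The axioms are those of a Hopf algebra, in the completed tensor powers of `A`. They are written
out on approximations: `ApproxAt n t (Δ a)` says that the finite sum `t = ∑ a' ⊗ a''` equals
`Δ a` modulo `(J ⊗ A + A ⊗ J) ^ n`. -/
structure TopHopfAlgebra (k A : Type*) [Field k] [Ring A] [Algebra k⟦X⟧ A] where
  /-- ideal of definition of the topology -/
  J : Ideal A
  [twoSided : J.IsTwoSided]
  h_mem : algebraMap k⟦X⟧ A (X : k⟦X⟧) ∈ J
  adicComplete : IsIdealAdicComplete J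
  /-- coproduct -/
  Δ : A →ₐ[k⟦X⟧] CTensor k⟦X⟧ J
  /-- counit -/
  ε : A →ₐ[k⟦X⟧] k⟦X⟧
  /-- antipode -/
  S : A →ₗ[k⟦X⟧] A
  Δ_continuous : ∀ a ∈ J, ApproxAt 1 0 (Δ a)
  S_continuous : ∀ n : ℕ, ∀ a ∈ J ^ n, S a ∈ J ^ n
  coassoc : ∀ (a : A) (n : ℕ) (t : A ⊗[k⟦X⟧] A), ApproxAt n t (Δ a) →
    comulLeft Δ n t = comulRight Δ n t
  counit_left : ∀ (a : A) (n : ℕ) (t : A ⊗[k⟦X⟧] A), ApproxAt n t (Δ a) →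
    TensorProduct.lid k⟦X⟧ A (TensorProduct.map ε.toLinearMap LinearMap.id t) - a ∈ J ^ n
  counit_right : ∀ (a : A) (n : ℕ) (t : A ⊗[k⟦X⟧] A), ApproxAt n t (Δ a) →
    TensorProduct.rid k⟦X⟧ A (TensorProduct.map LinearMap.id ε.toLinearMap t) - a ∈ J ^ n
  antipode_left : ∀ (a : A) (n : ℕ) (t : A ⊗[k⟦X⟧] A), ApproxAt n t (Δ a) →
    LinearMap.mul' k⟦X⟧ A (TensorProduct.map S LinearMap.id t) - algebraMap k⟦X⟧ A (ε a) ∈ J ^ n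
  antipode_right : ∀ (a : A) (n : ℕ) (t : A ⊗[k⟦X⟧] A), ApproxAt n t (Δ a) →
    LinearMap.mul' k⟦X⟧ A (TensorProduct.map LinearMap.id S t) - algebraMap k⟦X⟧ A (ε a) ∈ J ^ n

attribute [instance] TopHopfAlgebra.twoSided

/-- The `k[[h]]`-algebra `A` is a deformation of the `k`-algebra `A₀`: it is isomorphic to
`A₀[[h]]` as a `k[[h]]`-module, and `π : A → A₀` is a surjective ring homomorphism with kernel
`h A`, compatible with `k[[h]] → k`, so that it induces an isomorphism of algebras
`A / h A ≃ A₀`. -/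
structure IsDeformation {k A A₀ : Type*} [Field k] [Ring A] [Algebra k⟦X⟧ A] [Ring A₀]
    [Algebra k A₀] (π : A →+* A₀) : Prop where
  topologicallyFree : ∃ e : A ≃+ A₀⟦X⟧, ∀ (c : k⟦X⟧) (a : A),
    e (c • a) = PowerSeries.map (algebraMap k A₀) c * e a
  surjective : Function.Surjective π
  ker_eq : ∀ a : A, π a = 0 ↔ ∃ b : A, a = (X : k⟦X⟧) • b
  map_algebraMap : ∀ c : k⟦X⟧,
    π (algebraMap k⟦X⟧ A c) = algebraMap k A₀ (PowerSeries.constantCoeff c)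

/-! ### Duality functors: `Ext` and `RHom` into the ring -/

section Duality

variable (R : Type u) [Ring R]

/-- The contravariant functor `M ↦ Hom_R(M, R)` from left to right `R`-modules; the right action
is `(f · r)(m) = f(m) r`. -/
def homToRing : (ModuleCat.{u} R)ᵒᵖ ⥤ ModuleCat.{u} Rᵐᵒᵖ where
  obj M := ModuleCat.of Rᵐᵒᵖ (M.unop →ₗ[R] R)
  map f := ModuleCat.ofHom
    { toFun := fun g => g.comp f.unop.hom
      map_add' := fun _ _ => rfl
      map_smul' := fun _ _ => rfl }

instance : (homToRing R).Additive where
  map_add {M N f g} := by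
    refine ModuleCat.hom_ext (LinearMap.ext fun φ => LinearMap.ext fun m => ?_)
    exact map_add (show M.unop →ₗ[R] R from φ) _ _

/-- The right `R`-module `Ext^i_R(M, R)`. -/
noncomputable def extToRing (i : ℕ) (M : ModuleCat.{u} R) : ModuleCat.{u} Rᵐᵒᵖ :=
  (((homToRing R).rightOp.leftDerived i).obj M).unop

variable {R}

/-- The complex of right modules `Hom_R(P, R)`, for a chain complex `P` of left modules. -/
noncomputable def homComplex (P : ChainComplex (ModuleCat.{u} R) ℕ) :
    CochainComplex (ModuleCat.{u} Rᵐᵒᵖ) ℕ :=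
  (((homToRing R).rightOp.mapHomologicalComplex _).obj P).unop

/-- `D_R(M) = RHom_R(M, R)` as an object of the derived category of right `R`-modules, computed
by a projective resolution `P` of the left `R`-module `M`. -/
noncomputable def dualObj [HasDerivedCategory.{w} (ModuleCat.{u} Rᵐᵒᵖ)] {M : ModuleCat.{u} R}
    (P : ProjectiveResolution M) : DerivedCategory (ModuleCat.{u} Rᵐᵒᵖ) :=
  DerivedCategory.Q.obj ((homComplex P.complex).extend ComplexShape.embeddingUpNat)

end Duality

/-! ### The one-dimensional module given by the counit, and the twisted right action -/

/-- The left `R`-module with underlying module `K`, on which `R` acts through `ε : R → K`. -/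
noncomputable def augModule {K R : Type u} [CommRing K] [Ring R] (ε : R →+* K) :
    ModuleCat.{u} R :=
  (ModuleCat.restrictScalars ε).obj (ModuleCat.of K K)

/-- A right module over a `K`-algebra `R`, seen as a `K`-module. -/
noncomputable abbrev asBase (K : Type u) {R : Type u} [CommRing K] [Ring R] [Algebra K R]
    (M : ModuleCat.{u} Rᵐᵒᵖ) : ModuleCat.{u} K :=
  (ModuleCat.restrictScalars (algebraMap K Rᵐᵒᵖ)).obj M

/-- Convergence of a sequence in the `h`-adic topology of a `k[[h]]`-module. -/
def HTendsto {k W : Type*} [Field k] [AddCommGroup W] [Module k⟦X⟧ W] (x : ℕ → W) (y : W) :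
    Prop :=
  ∀ m : ℕ, ∃ N : ℕ, ∀ n ≥ N, ∃ w : W, x n - y = (X ^ m : k⟦X⟧) • w

section Twist

variable {k A : Type u} [Field k] [Ring A] [Algebra k⟦X⟧ A] (H : TopHopfAlgebra k A)
variable (V : Type u) [AddCommGroup V] [Module k⟦X⟧ V] [Module A V] [IsScalarTower k⟦X⟧ A V]
variable (Ω : Type u) [AddCommGroup Ω] [Module k⟦X⟧ Ω]

/-- The transposed right action on `V*`: `(f · a)(v) = f(a v)`. -/
noncomputable def dualAct {V : Type u} [AddCommGroup V] [Module k⟦X⟧ V] [Module A V] [IsScalarTower k⟦X⟧ A V]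
    (f : Module.Dual k⟦X⟧ V) : A →ₗ[k⟦X⟧] Module.Dual k⟦X⟧ V where
  toFun a := f.comp (Algebra.lsmul k⟦X⟧ k⟦X⟧ V a)
  map_add' a b := by ext v; simp
  map_smul' c a := by ext v; simp

variable {V Ω}

/-- For `t = ∑ u' ⊗ u''`, the element `∑ θ(u') ω ⊗ f · S²(u'')` of `Ω ⊗ V*`. -/
noncomputable def twistSum (θ : A →ₐ[k⟦X⟧] k⟦X⟧) (ω : Ω) (f : Module.Dual k⟦X⟧ V) :
    A ⊗[k⟦X⟧] A →ₗ[k⟦X⟧] Ω ⊗[k⟦X⟧] Module.Dual k⟦X⟧ V :=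
  TensorProduct.map (θ.toLinearMap.smulRight ω) ((dualAct f).comp (H.S.comp H.S))

/-- The right action `ρ` of `A` on `Ω ⊗ V*` is the twisted one:
`(ω ⊗ f) · u = lim_n ∑_j θ(u'_{j,n}) ω ⊗ f · S²(u''_{j,n})` whenever
`Δ(u) = lim_n ∑_j u'_{j,n} ⊗ u''_{j,n}`. -/
def IsTwistedAction (θ : A →ₐ[k⟦X⟧] k⟦X⟧)
    (ρ : Aᵐᵒᵖ →ₐ[k⟦X⟧] Module.End k⟦X⟧ (Ω ⊗[k⟦X⟧] Module.Dual k⟦X⟧ V)) : Prop :=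
  ∀ (u : A) (ω : Ω) (f : Module.Dual k⟦X⟧ V) (t : ℕ → A ⊗[k⟦X⟧] A),
    (∀ n, ApproxAt n (t n) (H.Δ u)) →
      HTendsto (k := k) (fun n => twistSum H θ ω f (t n)) (ρ (op u) (ω ⊗ₜ f))

end Twist

/-- The module defined by a representation `ρ` of `B` on the `K`-module `W`. -/
noncomputable def repModule {K B W : Type u} [CommRing K] [Ring B] [Algebra K B] [AddCommGroup W]
    [Module K W] (ρ : B →ₐ[K] Module.End K W) : ModuleCat.{u} B :=
  (ModuleCat.restrictScalars ρ.toRingHom).obj (ModuleCat.of (Module.End K W) W)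

/-! The mechanism is the tensor identity for Hopf algebras. For a left module N, Hom_A(N ⊗ V, A) ≅
Hom_A(N, V* ⊗ A), and V* ⊗ A with the diagonal action is free: it untwists to a finite power of A.
So Hom_A(N ⊗ V, A) is Hom_A(N, A) ⊗ V*, with a right action twisted through Δ and the double dual of
V, whence S². Since N ↦ N ⊗ V is exact and preserves projectives, the same holds for Ext
(`extToRingTwistIso`); for N = K one has K ⊗ V ≅ V.

No completed tensor product of modules is needed. The coefficients r_ij of V are continuous linear
forms, so a ↦ ∑ r_ij(a'') a' converges and gives a ring homomorphism from A to matrices over A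
(`TopHopfAlgebra.twist`). The antipode axioms become the matrix identities `IsDualTwist`, and the
rest of the twisting is algebra over an arbitrary ring. Continuity is automatic: J lies in the
Jacobson radical because A is complete, and V/hV is artinian and noetherian, so by Nakayama a power
of J kills V/hV.

Ext_A(K, A) is controlled by reduction modulo h. If P resolves K, then P/hP resolves k, because
everything is h-torsion free; Hom_A(P, A) is h-complete and torsion free, with reduction
Hom_{A₀}(P/hP, A₀). Vanishing (`exact_of_exact_reduction`) and rank one
(`exists_generator_of_reduction`) then lift by successive approximation. A right module free of rank
one over K is given by a character θ. Thus RHom_A(V, A) has cohomology only in degree d, and such a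
complex is isomorphic to that cohomology in the derived category (`nonempty_iso_singleFunctor`). -/

/-! ### Duality and projective resolutions -/

section Resolutions

variable {R : Type u} [Ring R]

/-- `Ext^i_R(M, R)` is computed by any projective resolution of `M`. -/
noncomputable def extToRingIso {M : ModuleCat.{u} R} (P : ProjectiveResolution M) (i : ℕ) :
    extToRing R i M ≅ (homComplex P.complex).homology i :=
  (P.isoLeftDerivedObj (homToRing R).rightOp i).symm.unop ≪≫
    (HomologicalComplex.homologyUnop _ i).symm

/-- A projective resolution from an exact augmented complex of projective modules. -/
noncomputable def CategoryTheory.ProjectiveResolution.ofExact {M : ModuleCat.{u} R}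
    (C : ChainComplex (ModuleCat.{u} R) ℕ) (hproj : ∀ n, Projective (C.X n))
    (aug : C.X 0 ⟶ M) (haug : C.d 1 0 ≫ aug = 0) (hsurj : Function.Surjective aug)
    (hzero : ∀ x, aug x = 0 → ∃ y, C.d 1 0 y = x)
    (hsucc : ∀ n x, C.d (n + 1) n x = 0 → ∃ y, C.d (n + 2) (n + 1) y = x) :
    ProjectiveResolution M where
  complex := C
  projective := hproj
  π := (ChainComplex.toSingle₀Equiv _ _).symm ⟨aug, haug⟩
  quasiIso := ⟨fun n => by
    cases n with
    | zero =>
      rw [ChainComplex.quasiIsoAt₀_iff, ShortComplex.quasiIso_iff_of_zeros']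
      · refine (ShortComplex.exact_and_epi_g_iff_of_iso
          (S₂ := ShortComplex.mk (C.d 1 0) aug haug) ?_).2 ⟨?_, ?_⟩
        · exact ShortComplex.isoMk (Iso.refl _) (Iso.refl _) (Iso.refl _)
            ((Category.id_comp _).trans (Category.comp_id _).symm)
            (((Category.id_comp _).trans
              (ChainComplex.toSingle₀Equiv_symm_apply_f_zero aug haug).symm).trans
              (Category.comp_id _).symm)
        · rw [ShortComplex.moduleCat_exact_iff]
          exact hzero
        · exact (ModuleCat.epi_iff_surjective _).2 hsurj
      · exact C.shape _ _ (by simp)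
      · rfl
      · rfl
    | succ n =>
      rw [quasiIsoAt_iff_exactAt']
      · rw [HomologicalComplex.exactAt_iff' _ (n + 2) (n + 1) n (by simp) (by simp),
          ShortComplex.moduleCat_exact_iff]
        exact hsucc n
      · apply ChainComplex.exactAt_succ_single_obj⟩

theorem CategoryTheory.ProjectiveResolution.exact_zero_apply {M : ModuleCat.{u} R} (P : ProjectiveResolution M)
    (x : P.complex.X 0) (hx : P.π.f 0 x = 0) : ∃ y, P.complex.d 1 0 y = x :=
  (ShortComplex.moduleCat_exact_iff _).1 P.exact₀ x hx

theorem CategoryTheory.ProjectiveResolution.exact_succ_apply {M : ModuleCat.{u} R} (P : ProjectiveResolution M)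
    (n : ℕ) (x : P.complex.X (n + 1)) (hx : P.complex.d (n + 1) n x = 0) :
    ∃ y, P.complex.d (n + 2) (n + 1) y = x :=
  (ShortComplex.moduleCat_exact_iff _).1 (P.exact_succ n) x hx

end Resolutions

/-! ### Homology classes in complexes of modules -/

section Homology

variable {R : Type u} [Ring R]

/-- The homology of a short complex of modules is the quotient of cycles by boundaries. -/
noncomputable def shortHomologyEquiv (S : ShortComplex (ModuleCat.{u} R)) :
    (LinearMap.ker S.g.hom ⧸ LinearMap.range S.moduleCatToCycles) ≃ₗ[R] S.homology :=
  S.moduleCatHomologyIso.symm.toLinearEquiv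

/-- The class of a cycle in the homology of a short complex of modules. -/
noncomputable def shortHomologyClass (S : ShortComplex (ModuleCat.{u} R)) :
    LinearMap.ker S.g.hom →ₗ[R] S.homology :=
  (shortHomologyEquiv S).toLinearMap.comp (Submodule.mkQ _)

theorem shortHomologyClass_surjective (S : ShortComplex (ModuleCat.{u} R)) :
    Function.Surjective (shortHomologyClass S) := by
  exact (shortHomologyEquiv S).surjective.comp (Submodule.mkQ_surjective _)

theorem shortHomologyClass_eq_zero_iff (S : ShortComplex (ModuleCat.{u} R))
    (x : LinearMap.ker S.g.hom) : shortHomologyClass S x = 0 ↔ ∃ y, S.f y = x := by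
  unfold shortHomologyClass
  rw [LinearMap.comp_apply, LinearEquiv.coe_coe, LinearEquiv.map_eq_zero_iff, Submodule.mkQ_apply,
    Submodule.Quotient.mk_eq_zero]
  constructor
  · rintro ⟨y, hy⟩
    exact ⟨y, congrArg Subtype.val hy⟩
  · rintro ⟨y, hy⟩
    exact ⟨y, Subtype.ext hy⟩

variable {ι : Type*} {c : ComplexShape ι}

/-- The class of a cycle in the homology of a complex of modules. -/
noncomputable def homologyClass (C : HomologicalComplex (ModuleCat.{u} R) c) (i : ι) :
    LinearMap.ker (C.d i (c.next i)).hom →ₗ[R] C.homology i :=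
  shortHomologyClass (C.sc i)

theorem homologyClass_surjective (C : HomologicalComplex (ModuleCat.{u} R) c) (i : ι) :
    Function.Surjective (homologyClass C i) :=
  shortHomologyClass_surjective (C.sc i)

theorem homologyClass_eq_zero_iff (C : HomologicalComplex (ModuleCat.{u} R) c) (i : ι)
    (x : LinearMap.ker (C.d i (c.next i)).hom) :
    homologyClass C i x = 0 ↔ ∃ y, C.d (c.prev i) i y = x :=
  shortHomologyClass_eq_zero_iff (C.sc i) x

theorem subsingleton_homology_iff (C : HomologicalComplex (ModuleCat.{u} R) c) (i : ι) :
    Subsingleton (C.homology i) ↔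
      ∀ x, C.d i (c.next i) x = 0 → ∃ y, C.d (c.prev i) i y = x := by
  constructor
  · intro h x hx
    exact (homologyClass_eq_zero_iff C i ⟨x, hx⟩).1 (Subsingleton.elim _ _)
  · intro h
    refine subsingleton_of_forall_eq 0 fun x => ?_
    obtain ⟨y, rfl⟩ := homologyClass_surjective C i x
    exact (homologyClass_eq_zero_iff C i y).2 (h y.1 y.2)

end Homology

/-! ### Complexes with cohomology in a single degree -/

section Derived

/-- A cochain complex whose cohomology is concentrated in degree `d` is isomorphic, in the derived
category, to its cohomology placed in degree `d`. -/
theorem nonempty_iso_singleFunctor {C : Type*} [Category C] [Abelian C]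
    [HasDerivedCategory.{w} C] (K : CochainComplex C ℕ) (d : ℕ)
    (hK : ∀ i, i ≠ d → Limits.IsZero (K.homology i)) (Y : C) (e : K.homology d ≅ Y) :
    Nonempty (DerivedCategory.Q.obj (K.extend ComplexShape.embeddingUpNat) ≅
      (DerivedCategory.singleFunctor C (d : ℤ)).obj Y) := by
  let L := K.extend ComplexShape.embeddingUpNat
  let X := DerivedCategory.Q.obj L
  have hfac : ∀ i, (DerivedCategory.homologyFunctor C i).obj X ≅ L.homology i := fun i =>
    (DerivedCategory.homologyFunctorFactors C i).app L
  have hL : ∀ i : ℤ, i ≠ d → Limits.IsZero (L.homology i) := by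
    intro i hi
    by_cases h : ∃ j, ComplexShape.embeddingUpNat.f j = i
    · obtain ⟨j, rfl⟩ := h
      refine (hK j ?_).of_iso (K.extendHomologyIso ComplexShape.embeddingUpNat rfl)
      rintro rfl
      exact hi rfl
    · exact (K.extend_exactAt ComplexShape.embeddingUpNat i
        fun j hj => h ⟨j, hj⟩).isZero_homology
  have hge : X.IsGE d := (DerivedCategory.isGE_iff X d).2 fun i hi =>
    (hL i hi.ne).of_iso (hfac i)
  have hle : X.IsLE d := (DerivedCategory.isLE_iff X d).2 fun i hi =>
    (hL i hi.ne').of_iso (hfac i)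
  obtain ⟨Z, ⟨f⟩⟩ := X.exists_iso_singleFunctor_obj_of_isGE_of_isLE d
  have hZ : Z ≅ Y := ((DerivedCategory.singleFunctorCompHomologyFunctorIso C d).app Z).symm ≪≫
    (DerivedCategory.homologyFunctor C d).mapIso f.symm ≪≫ hfac d ≪≫
    K.extendHomologyIso ComplexShape.embeddingUpNat rfl ≪≫ e
  exact ⟨f ≪≫ (DerivedCategory.singleFunctor C (d : ℤ)).mapIso hZ⟩

end Derived

/-! ### Twisting modules by a ring homomorphism into matrices -/

section MatrixTwist

variable {ι : Type} [Fintype ι] {R : Type u} [Ring R]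

/-- The `R`-module structure on `N ^ ι` given by a ring homomorphism `T` from `R` to matrices over
`R`: it is `N ⊗ V` with the diagonal action when `T` describes the action of a bialgebra `R`
on `V`. -/
def Twisted [DecidableEq ι] (_ : R →+* Matrix ι ι R) (N : Type*) : Type _ := ι → N

namespace Twisted

variable [DecidableEq ι] {T : R →+* Matrix ι ι R} {N N' : Type*}

/-- The element with given coordinates. -/
def mk (T : R →+* Matrix ι ι R) (y : ι → N) : Twisted T N := y

/-- The coordinates of an element. -/
def coord (y : Twisted T N) (i : ι) : N := (y : ι → N) i

@[simp]
theorem coord_mk (y : ι → N) (i : ι) : (mk T y).coord i = y i := rfl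

theorem ext {x y : Twisted T N} (h : ∀ i, x.coord i = y.coord i) : x = y := funext h

instance [AddCommGroup N] : AddCommGroup (Twisted T N) :=
  inferInstanceAs (AddCommGroup (ι → N))

section

variable [AddCommGroup N] [AddCommGroup N']

@[simp]
theorem coord_add (x y : Twisted T N) (i : ι) : (x + y).coord i = x.coord i + y.coord i := rfl

@[simp]
theorem coord_zero (i : ι) : (0 : Twisted T N).coord i = 0 := rfl

variable (T) in
/-- The vector with `n` in position `i`. -/
def single (i : ι) : N →+ Twisted T N := AddMonoidHom.single (fun _ : ι => N) i

@[simp]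
theorem coord_single (i j : ι) (n : N) :
    (single T i n).coord j = if j = i then n else 0 := Pi.single_apply i n j

@[simp]
theorem coord_sum {α : Type*} (s : Finset α) (f : α → Twisted T N) (j : ι) :
    (∑ a ∈ s, f a).coord j = ∑ a ∈ s, (f a).coord j := Finset.sum_apply j s f

theorem sum_single (y : Twisted T N) : ∑ i, single T i (y.coord i) = y :=
  ext fun j => by simp

variable [Module R N] [Module R N']

instance : Module R (Twisted T N) where
  smul u y := mk T fun i => ∑ j, T u i j • y.coord j
  one_smul y := ext fun i => by
    change ∑ j, T 1 i j • y.coord j = y.coord i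
    simp [Matrix.one_apply]
  mul_smul u v y := ext fun i => by
    change ∑ j, T (u * v) i j • y.coord j = ∑ j, T u i j • ∑ l, T v j l • y.coord l
    simp only [map_mul, Matrix.mul_apply, Finset.sum_smul, Finset.smul_sum, mul_smul]
    exact Finset.sum_comm
  smul_zero u := ext fun i => by
    change ∑ j, T u i j • (0 : N) = 0
    simp
  smul_add u x y := ext fun i => by
    change ∑ j, T u i j • (x.coord j + y.coord j) =
      ∑ j, T u i j • x.coord j + ∑ j, T u i j • y.coord j
    simp [smul_add, Finset.sum_add_distrib]
  add_smul u v y := ext fun i => by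
    change ∑ j, T (u + v) i j • y.coord j =
      ∑ j, T u i j • y.coord j + ∑ j, T v i j • y.coord j
    simp [add_smul, Finset.sum_add_distrib]
  zero_smul y := ext fun i => by
    change ∑ j, T 0 i j • y.coord j = 0
    simp

@[simp]
theorem coord_smul (u : R) (y : Twisted T N) (i : ι) :
    (u • y).coord i = ∑ j, T u i j • y.coord j := rfl

variable (T) in
/-- Functoriality of `Twisted`. -/
def map (f : N →ₗ[R] N') : Twisted T N →ₗ[R] Twisted T N' where
  toFun y := mk T fun i => f (y.coord i)
  map_add' x y := ext fun i => by simp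
  map_smul' u y := ext fun i => by simp

theorem map_single (f : N →ₗ[R] N') (i : ι) (n : N) :
    map T f (single T i n) = single T i (f n) := ext fun j => by
  change f ((single T i n).coord j) = _
  rw [coord_single, coord_single]
  split_ifs <;> simp

theorem smul_single (u : R) (i : ι) (n : N) :
    u • single T i n = ∑ l, single T l (T u l i • n) :=
  ext fun j => by simp

end

end Twisted

variable [DecidableEq ι] (T S U : R →+* Matrix ι ι R)

/-- `S` is a dual of `T`: for the twists of a Hopf algebra by a representation `V` and by its
dual, these are the two antipode axioms. -/
structure IsDualTwist : Prop where
  left : ∀ a l i, ∑ j, T (S a i j) l j = if l = i then a else 0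
  right : ∀ a l i, ∑ j, S (T a j i) j l = if l = i then a else 0

namespace Twisted

variable {T S U} {N N' : Type*} [AddCommGroup N] [Module R N] [AddCommGroup N'] [Module R N']

/-- `Hom_R(N ⊗ V, N') ≃ Hom_R(N, V* ⊗ N')`. -/
def homEquiv (h : IsDualTwist T S) : (Twisted T N →ₗ[R] N') ≃ (N →ₗ[R] Twisted S N') where
  toFun g :=
    { toFun := fun n => mk S fun i => g (single T i n)
      map_add' := fun x y => ext fun i => by simp
      map_smul' := fun u n => ext fun i => by
        -- The entries of S(u) act on the vectors `single T j n` through T; summing over j, the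
        -- first antipode identity collapses the result to `single T i (u • n)`.
        simp only [coord_mk, coord_smul, RingHom.id_apply, ← map_smul, smul_single]
        rw [← map_sum, Finset.sum_comm]
        simp only [← map_sum, ← Finset.sum_smul, h.left]
        congr 1
        refine ext fun j => ?_
        simp only [coord_single, coord_sum, ite_smul, zero_smul]
        rw [Finset.sum_ite_eq Finset.univ j, if_pos (Finset.mem_univ j)] }
  invFun φ :=
    { toFun := fun y => ∑ i, (φ (y.coord i)).coord i
      map_add' := fun x y => by simp [Finset.sum_add_distrib]
      map_smul' := fun u y => by
        simp only [coord_smul, map_sum, map_smul, coord_sum, RingHom.id_apply]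
        rw [Finset.sum_comm]
        simp only [Finset.smul_sum]
        refine Finset.sum_congr rfl fun l _ => ?_
        rw [Finset.sum_comm]
        simp only [← Finset.sum_smul, h.right]
        simp }
  left_inv g := by
    refine LinearMap.ext fun y => ?_
    change ∑ i, g (single T i (y.coord i)) = g y
    rw [← map_sum, sum_single]
  right_inv φ := by
    refine LinearMap.ext fun n => ext fun j => ?_
    change ∑ i, (φ ((single T j n).coord i)).coord i = (φ n).coord j
    rw [Finset.sum_eq_single j]
    · simp
    · intro b _ hb
      simp [hb]
    · simp

/-- The free module on `ι` is isomorphic to its twist `V* ⊗ R`. -/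
def untwist (h : IsDualTwist S U) : (ι → R) ≃ₗ[R] Twisted S R where
  -- The image of a is ∑ a_j • `single S j 1`: these vectors form a basis of the twist, and the dual
  -- twist U computes coordinates in it.
  toFun a := mk S fun i => ∑ j, S (a j) i j
  invFun x := fun j => ∑ i, U (x.coord i) i j
  map_add' a b := ext fun i => by simp [Finset.sum_add_distrib]
  map_smul' u a := ext fun i => by
    simp only [coord_mk, coord_smul, Pi.smul_apply, smul_eq_mul, map_mul, Matrix.mul_apply,
      RingHom.id_apply, Finset.mul_sum]
    exact Finset.sum_comm
  left_inv a := by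
    funext j
    simp only [coord_mk, map_sum, Matrix.sum_apply]
    rw [Finset.sum_comm]
    simp [h.right]
  right_inv x := ext fun i => by
    simp only [coord_mk, map_sum, Matrix.sum_apply]
    rw [Finset.sum_comm]
    simp [h.left]

end Twisted

/-- The functor `N ↦ N ⊗ V`. -/
def twistFunctor : ModuleCat.{u} R ⥤ ModuleCat.{u} R where
  obj N := ModuleCat.of R (Twisted T N)
  map f := ModuleCat.ofHom (Twisted.map T f.hom)

instance : (twistFunctor T).Additive where
  map_add := rfl

/-- Additively the functor is N ↦ N^ι, so exactness is checked coordinate by coordinate. -/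
instance : (twistFunctor T).PreservesHomology :=
  Functor.preservesHomology_of_map_exact _ fun Z hZ => by
    rw [ShortComplex.moduleCat_exact_iff] at hZ ⊢
    intro x hx
    choose y hy using fun i => hZ (Twisted.coord (N := Z.X₂) x i) (congrFun hx i)
    exact ⟨Twisted.mk T y, funext hy⟩

variable {T S} in
/-- The functor `N ↦ N ⊗ V` is left adjoint to `N ↦ V* ⊗ N`. -/
def twistAdjunction (h : IsDualTwist T S) : twistFunctor T ⊣ twistFunctor S :=
  Adjunction.mkOfHomEquiv
    { homEquiv := fun N N' => (ModuleCat.homEquiv (M := (twistFunctor T).obj N) (N := N')).trans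
        ((Twisted.homEquiv h).trans
          (ModuleCat.homEquiv (M := N) (N := (twistFunctor S).obj N')).symm)
      homEquiv_naturality_left_symm := by
        intros
        rfl
      homEquiv_naturality_right := by
        intros
        rfl }

variable {T S} in
-- A left adjoint preserves projectives when its right adjoint, here the exact twist by S, preserves
-- epimorphisms.
theorem IsDualTwist.preservesProjectiveObjects (h : IsDualTwist T S) :
    (twistFunctor T).PreservesProjectiveObjects where
  projective_obj {X} hX := by
    have : (twistFunctor S).PreservesEpimorphisms := inferInstance
    exact (twistAdjunction h).map_projective X hX

/-- The twist of right modules by `U`: `(c · u)_j = ∑ c_m · U(u)_{mj}`. -/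
def opTwist : Rᵐᵒᵖ →+* Matrix ι ι Rᵐᵒᵖ where
  toFun u := Matrix.of fun j m => op (U u.unop m j)
  map_one' := by
    ext j m
    rw [Matrix.of_apply, unop_one, map_one, Matrix.one_apply, Matrix.one_apply]
    by_cases h : m = j
    · simp [h]
    · simp [h, Ne.symm h]
  map_mul' u v := by
    ext j m
    simp [Matrix.mul_apply]
  map_zero' := by
    ext j m
    simp
  map_add' u v := by
    ext j m
    simp

variable {T S U}

/-- `Hom_R(N ⊗ V, R)` is isomorphic to `Hom_R(N, R) ⊗ V*`, with the right action twisted by the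
double dual `U`. -/
def twistedDualEquiv (h : IsDualTwist T S) (h' : IsDualTwist S U) (N : Type*) [AddCommGroup N]
    [Module R N] : (Twisted T N →ₗ[R] R) ≃ₗ[Rᵐᵒᵖ] Twisted (opTwist U) (N →ₗ[R] R) where
  toFun g := Twisted.mk _ fun j =>
    (LinearMap.proj j).comp ((Twisted.untwist h').symm.toLinearMap.comp (Twisted.homEquiv h g))
  invFun c := (Twisted.homEquiv h).symm
    ((Twisted.untwist h').toLinearMap.comp (LinearMap.pi c.coord))
  map_add' g g' := Twisted.ext fun j => LinearMap.ext fun n => by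
    change ∑ i, U (g (Twisted.single T i n) + g' (Twisted.single T i n)) i j =
      ∑ i, U (g (Twisted.single T i n)) i j + ∑ i, U (g' (Twisted.single T i n)) i j
    simp [Finset.sum_add_distrib]
  map_smul' u g := Twisted.ext fun j => LinearMap.ext fun n => by
    rw [Twisted.coord_smul, LinearMap.sum_apply]
    -- Since U is multiplicative, right multiplication of the values by u becomes right
    -- multiplication by the matrix U(u); this is where the twist of the right action comes from.
    change ∑ i, U (g (Twisted.single T i n) * u.unop) i j =
      ∑ m, (∑ i, U (g (Twisted.single T i n)) i m) * U u.unop m j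
    simp only [map_mul, Matrix.mul_apply, Finset.sum_mul]
    exact Finset.sum_comm
  left_inv g := by
    apply (Twisted.homEquiv h).injective
    rw [Equiv.apply_symm_apply]
    refine LinearMap.ext fun n => ?_
    exact (Twisted.untwist h').apply_symm_apply _
  right_inv c := Twisted.ext fun j => LinearMap.ext fun n => by
    simp only [Equiv.apply_symm_apply, Twisted.coord_mk, LinearMap.comp_apply,
      LinearEquiv.coe_coe, LinearEquiv.symm_apply_apply]
    rfl

/-- The complex `Hom_R(P ⊗ V, R)` is the twist of `Hom_R(P, R)`. -/
noncomputable def homComplexTwistIso (h : IsDualTwist T S) (h' : IsDualTwist S U)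
    (P : ChainComplex (ModuleCat.{u} R) ℕ) :
    homComplex (((twistFunctor T).mapHomologicalComplex _).obj P) ≅
      ((twistFunctor (opTwist U)).mapHomologicalComplex _).obj (homComplex P) :=
  HomologicalComplex.Hom.isoOfComponents
    (fun i => (twistedDualEquiv h h' (P.X i)).toModuleIso)
    (fun i j _ => by
      refine ModuleCat.hom_ext (LinearMap.ext fun (g : Twisted T (P.X i) →ₗ[R] R) =>
        Twisted.ext (T := opTwist U) (N := P.X j →ₗ[R] R) fun l =>
          LinearMap.ext fun (n : P.X j) => ?_)
      change ∑ a, U (g (Twisted.single T a (P.d j i n))) a l =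
        ∑ a, U (g (Twisted.map T (P.d j i).hom (Twisted.single T a n))) a l
      simp only [Twisted.map_single])

/-- `Ext_R(N ⊗ V, R)` is the twist of `Ext_R(N, R)`. -/
noncomputable def extToRingTwistIso (h : IsDualTwist T S) (h' : IsDualTwist S U)
    {M : ModuleCat.{u} R} (i : ℕ) :
    extToRing R i ((twistFunctor T).obj M) ≅ (twistFunctor (opTwist U)).obj (extToRing R i M) :=
  letI := h.preservesProjectiveObjects
  let P := projectiveResolution M
  extToRingIso ((twistFunctor T).mapProjectiveResolution P) i ≪≫
    (HomologicalComplex.homologyFunctor _ _ i).mapIso (homComplexTwistIso h h' P.complex) ≪≫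
    ((homComplex P.complex).sc i).mapHomologyIso (twistFunctor (opTwist U)) ≪≫
    (twistFunctor (opTwist U)).mapIso (extToRingIso P i).symm

end MatrixTwist

/-! ### Powers of the ideals of completed tensor products -/

section TensorIdeals

/-- Right exactness of the tensor product; no flatness is involved. -/
theorem TensorProduct.mem_span_of_map_eq_zero {K : Type*} [CommRing K] {M M' N N' : Type*}
    [AddCommGroup M] [Module K M] [AddCommGroup M'] [Module K M'] [AddCommGroup N] [Module K N]
    [AddCommGroup N'] [Module K N'] (g : M →ₗ[K] M') (g' : N →ₗ[K] N')
    (hg : Function.Surjective g) (hg' : Function.Surjective g') (z : M ⊗[K] N)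
    (hz : TensorProduct.map g g' z = 0) :
    z ∈ Submodule.span K {w | ∃ x y, (g x = 0 ∨ g' y = 0) ∧ x ⊗ₜ[K] y = w} := by
  have hz' : z ∈ LinearMap.ker (TensorProduct.map g g') := hz
  rw [TensorProduct.map_ker (f := (LinearMap.ker g).subtype) (f' := (LinearMap.ker g').subtype)
    (LinearMap.exact_subtype_ker_map g) hg (LinearMap.exact_subtype_ker_map g') hg'] at hz'
  obtain ⟨_, ⟨a, rfl⟩, _, ⟨b, rfl⟩, rfl⟩ := Submodule.mem_sup.1 hz'
  clear hz hz'
  refine add_mem ?_ ?_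
  · induction a with
    | zero => rw [map_zero]; exact zero_mem _
    | tmul x y => exact Submodule.subset_span ⟨x, y, Or.inr y.2, rfl⟩
    | add a b ha hb => rw [map_add]; exact add_mem ha hb
  · induction b with
    | zero => rw [map_zero]; exact zero_mem _
    | tmul x y => exact Submodule.subset_span ⟨x, y, Or.inl x.2, rfl⟩
    | add a b ha hb => rw [map_add]; exact add_mem ha hb

theorem Ideal.mem_pow_zero {B : Type*} [Ring B] (I : Ideal B) (x : B) : x ∈ I ^ 0 := by
  rw [Submodule.pow_zero, Ideal.one_eq_top]
  trivial

variable {K A : Type*} [CommRing K] [Ring A] [Algebra K A] (J : Ideal A) [J.IsTwoSided]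

theorem Ideal.mul_mem_pow_add {x y : A} {p q : ℕ} (hx : x ∈ J ^ p) (hy : y ∈ J ^ q) :
    x * y ∈ J ^ (p + q) := by
  -- The case q = 0 is separate: J^0 is the whole ring, and J^p absorbs it on the right because it
  -- is two-sided.
  rcases Nat.eq_zero_or_pos q with rfl | hq
  · exact Ideal.mul_mem_right _ _ hx
  · rw [Submodule.pow_add _ hq.ne']
    exact Ideal.mul_mem_mul hx hy

variable (K)

/-- The depths of the two factors add up to n, so for n large one of them is deep. This is what
makes slicing by a continuous form continuous. -/
theorem tensorIdeal₂_pow_le (n : ℕ) (z : A ⊗[K] A) (hz : z ∈ tensorIdeal₂ K J ^ n) :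
    z ∈ Submodule.span K {w | ∃ p q x y, p + q = n ∧ x ∈ J ^ p ∧ y ∈ J ^ q ∧ x ⊗ₜ[K] y = w} := by
  induction n generalizing z with
  | zero =>
    induction z with
    | zero => exact zero_mem _
    | tmul x y => exact Submodule.subset_span ⟨0, 0, x, y, rfl, Ideal.mem_pow_zero _ _,
        Ideal.mem_pow_zero _ _, rfl⟩
    | add a b ha hb =>
      exact add_mem (ha (Ideal.mem_pow_zero _ _)) (hb (Ideal.mem_pow_zero _ _))
  | succ n ih =>
    rw [Submodule.pow_succ] at hz
    induction hz using Submodule.smul_induction_on' with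
    | add x _ y _ hx hy => exact add_mem hx hy
    | smul r hr m hm =>
      have h1 := ih r hr
      have h2 := TensorProduct.mem_span_of_map_eq_zero (Ideal.Quotient.mkₐ K J).toLinearMap
        (Ideal.Quotient.mkₐ K J).toLinearMap Ideal.Quotient.mk_surjective
        Ideal.Quotient.mk_surjective m hm
      have h3 := Submodule.mul_mem_mul h1 h2
      rw [Submodule.span_mul_span] at h3
      refine Submodule.span_le.2 ?_ h3
      rintro _ ⟨_, ⟨p, q, x, y, rfl, hx, hy, rfl⟩, _, ⟨x', y', h, rfl⟩, rfl⟩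
      refine Submodule.subset_span ?_
      rcases h with h | h
      · refine ⟨p + 1, q, x * x', y * y', by omega, Ideal.mul_mem_pow_add J hx ?_,
          Ideal.mul_mem_right _ _ hy, (Algebra.TensorProduct.tmul_mul_tmul _ _ _ _).symm⟩
        rw [Submodule.pow_one]
        exact Ideal.Quotient.eq_zero_iff_mem.1 h
      · refine ⟨p, q + 1, x * x', y * y', by omega, Ideal.mul_mem_right _ _ hx,
          Ideal.mul_mem_pow_add J hy ?_, (Algebra.TensorProduct.tmul_mul_tmul _ _ _ _).symm⟩
        rw [Submodule.pow_one]
        exact Ideal.Quotient.eq_zero_iff_mem.1 h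

theorem tensorIdeal₃_pow_le (n : ℕ) (z : A ⊗[K] (A ⊗[K] A)) (hz : z ∈ tensorIdeal₃ K J ^ n) :
    z ∈ Submodule.span K {w | ∃ p q r x y v, p + q + r = n ∧ x ∈ J ^ p ∧ y ∈ J ^ q ∧ v ∈ J ^ r ∧
      x ⊗ₜ[K] (y ⊗ₜ[K] v) = w} := by
  induction n generalizing z with
  | zero =>
    induction z with
    | zero => exact zero_mem _
    | tmul x w =>
      induction w with
      | zero => rw [TensorProduct.tmul_zero]; exact zero_mem _
      | tmul y v =>
        exact Submodule.subset_span ⟨0, 0, 0, x, y, v, rfl, Ideal.mem_pow_zero _ _,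
          Ideal.mem_pow_zero _ _, Ideal.mem_pow_zero _ _, rfl⟩
      | add a b ha hb =>
        rw [TensorProduct.tmul_add]
        exact add_mem (ha (Ideal.mem_pow_zero _ _)) (hb (Ideal.mem_pow_zero _ _))
    | add a b ha hb =>
      exact add_mem (ha (Ideal.mem_pow_zero _ _)) (hb (Ideal.mem_pow_zero _ _))
  | succ n ih =>
    rw [Submodule.pow_succ] at hz
    induction hz using Submodule.smul_induction_on' with
    | add x _ y _ hx hy => exact add_mem hx hy
    | smul r hr m hm =>
      have h1 := ih r hr
      have hsurj : Function.Surjective (Ideal.Quotient.mkₐ K J).toLinearMap :=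
        Ideal.Quotient.mk_surjective
      have h2 : m ∈ Submodule.span K
          {w | ∃ x y v, (x ∈ J ∨ y ∈ J ∨ v ∈ J) ∧ x ⊗ₜ[K] (y ⊗ₜ[K] v) = w} := by
        refine Submodule.span_le.2 ?_ (TensorProduct.mem_span_of_map_eq_zero
          (Ideal.Quotient.mkₐ K J).toLinearMap
          (TensorProduct.map (Ideal.Quotient.mkₐ K J).toLinearMap
            (Ideal.Quotient.mkₐ K J).toLinearMap) hsurj
          (TensorProduct.map_surjective hsurj hsurj) m hm)
        rintro _ ⟨x, w, h | h, rfl⟩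
        · induction w with
          | zero => rw [TensorProduct.tmul_zero]; exact zero_mem _
          | tmul y v =>
            exact Submodule.subset_span ⟨x, y, v, Or.inl (Ideal.Quotient.eq_zero_iff_mem.1 h), rfl⟩
          | add a b ha hb => rw [TensorProduct.tmul_add]; exact add_mem ha hb
        · have h3 := TensorProduct.mem_span_of_map_eq_zero _ _ hsurj hsurj w h
          clear h
          induction h3 using Submodule.span_induction with
          | mem w hw =>
            obtain ⟨y, v, h, rfl⟩ := hw
            exact Submodule.subset_span ⟨x, y, v, Or.inr
              (h.imp Ideal.Quotient.eq_zero_iff_mem.1 Ideal.Quotient.eq_zero_iff_mem.1), rfl⟩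
          | zero => rw [TensorProduct.tmul_zero]; exact zero_mem _
          | add a b _ _ ha hb => rw [TensorProduct.tmul_add]; exact add_mem ha hb
          | smul c a _ ha => rw [TensorProduct.tmul_smul]; exact Submodule.smul_mem _ c ha
      have h3 := Submodule.mul_mem_mul h1 h2
      rw [Submodule.span_mul_span] at h3
      refine Submodule.span_le.2 ?_ h3
      rintro _ ⟨_, ⟨p, q, s, x, y, v, rfl, hx, hy, hv, rfl⟩, _, ⟨x', y', v', h, rfl⟩, rfl⟩
      refine Submodule.subset_span ?_
      have hmul : (x * x') ⊗ₜ[K] ((y * y') ⊗ₜ[K] (v * v')) =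
          x ⊗ₜ[K] (y ⊗ₜ[K] v) * x' ⊗ₜ[K] (y' ⊗ₜ[K] v') := by
        rw [Algebra.TensorProduct.tmul_mul_tmul, Algebra.TensorProduct.tmul_mul_tmul]
      have hone : ∀ {a : A}, a ∈ J → a ∈ J ^ 1 := fun h => by rwa [Submodule.pow_one]
      rcases h with h | h | h
      · exact ⟨p + 1, q, s, x * x', y * y', v * v', by omega, Ideal.mul_mem_pow_add J hx (hone h),
          Ideal.mul_mem_right _ _ hy, Ideal.mul_mem_right _ _ hv, hmul⟩
      · exact ⟨p, q + 1, s, x * x', y * y', v * v', by omega, Ideal.mul_mem_right _ _ hx,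
          Ideal.mul_mem_pow_add J hy (hone h), Ideal.mul_mem_right _ _ hv, hmul⟩
      · exact ⟨p, q, s + 1, x * x', y * y', v * v', by omega, Ideal.mul_mem_right _ _ hx,
          Ideal.mul_mem_right _ _ hy, Ideal.mul_mem_pow_add J hv (hone h), hmul⟩

end TensorIdeals

/-! ### Approximations of elements of a completion -/

section Approx

variable {K B : Type*} [CommRing K] [Ring B] [Algebra K B] {I : Ideal B} [I.IsTwoSided]

theorem exists_approxAt (n : ℕ) (z : adicCompl K I) : ∃ t, ApproxAt n t z :=
  Ideal.Quotient.mk_surjective _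

theorem ApproxAt.of_le {m n : ℕ} (h : m ≤ n) {t : B} {z : adicCompl K I} (ht : ApproxAt n t z) :
    ApproxAt m t z := by
  induction n, h using Nat.le_induction with
  | base => exact ht
  | succ n _ ih =>
    refine ih ?_
    have h := z.2 n
    unfold ApproxAt at ht ⊢
    rw [← h, ← ht]
    rfl

theorem ApproxAt.sub_mem {n : ℕ} {t t' : B} {z : adicCompl K I} (ht : ApproxAt n t z)
    (ht' : ApproxAt n t' z) : t - t' ∈ I ^ n :=
  Ideal.Quotient.eq.1 (Eq.trans ht (Eq.symm ht'))

theorem ApproxAt.mul {n : ℕ} {t t' : B} {z z' : adicCompl K I} (ht : ApproxAt n t z)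
    (ht' : ApproxAt n t' z') : ApproxAt n (t * t') (z * z') := by
  unfold ApproxAt at *
  rw [map_mul, ht, ht']
  rfl

theorem ApproxAt.add {n : ℕ} {t t' : B} {z z' : adicCompl K I} (ht : ApproxAt n t z)
    (ht' : ApproxAt n t' z') : ApproxAt n (t + t') (z + z') := by
  unfold ApproxAt at *
  rw [map_add, ht, ht']
  rfl

theorem ApproxAt.smul {n : ℕ} {t : B} {z : adicCompl K I} (c : K) (ht : ApproxAt n t z) :
    ApproxAt n (c • t) (c • z) := by
  unfold ApproxAt at *
  change (Ideal.Quotient.mkₐ K (I ^ n)) (c • t) = _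
  rw [map_smul]
  change c • Ideal.Quotient.mk (I ^ n) t = _
  rw [ht]
  rfl

theorem approxAt_one (n : ℕ) : ApproxAt n (1 : B) (1 : adicCompl K I) := rfl

theorem approxAt_of_sub_mem {n : ℕ} {t t' : B} {z : adicCompl K I} (ht : ApproxAt n t z)
    (h : t' - t ∈ I ^ n) : ApproxAt n t' z :=
  (Ideal.Quotient.eq.2 h).trans ht

end Approx

/-! ### Contraction of the coproduct with a continuous linear form -/

theorem PowerSeries.eq_zero_of_forall_X_pow_dvd {k : Type*} [Field k] {c : k⟦X⟧}
    (h : ∀ m : ℕ, (X : k⟦X⟧) ^ m ∣ c) : c = 0 := by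
  ext n
  exact X_pow_dvd_iff.1 (h (n + 1)) n n.lt_succ_self

section Slice

variable {K A : Type*} [CommRing K] [Ring A] [Algebra K A]

/-- `x ⊗ y ↦ l(y) x`. -/
noncomputable def slice (l : A →ₗ[K] K) : A ⊗[K] A →ₗ[K] A :=
  (TensorProduct.rid K A).toLinearMap.comp (TensorProduct.map LinearMap.id l)

@[simp]
theorem slice_tmul (l : A →ₗ[K] K) (x y : A) : slice l (x ⊗ₜ y) = l y • x := by
  simp [slice]

/-- `x ⊗ y ⊗ z ↦ l(y) l'(z) x`. -/
noncomputable def slice₃ (l l' : A →ₗ[K] K) : A ⊗[K] (A ⊗[K] A) →ₗ[K] A :=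
  (TensorProduct.rid K A).toLinearMap.comp
    (TensorProduct.map LinearMap.id (l.comp (slice l')))

@[simp]
theorem slice₃_tmul (l l' : A →ₗ[K] K) (x y z : A) :
    slice₃ l l' (x ⊗ₜ (y ⊗ₜ z)) = (l' z * l y) • x := by
  simp [slice₃]

end Slice

namespace TopHopfAlgebra

variable {k A : Type u} [Field k] [Ring A] [Algebra k⟦X⟧ A] (H : TopHopfAlgebra k A)

theorem eq_of_forall_sub_mem {a b : A} (h : ∀ m : ℕ, a - b ∈ H.J ^ m) : a = b :=
  sub_eq_zero.1 (H.adicComplete.separated _ h)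

theorem smul_mem_J_pow (c : k⟦X⟧) {a : A} {m : ℕ} (ha : a ∈ H.J ^ m) : c • a ∈ H.J ^ m := by
  rw [Algebra.smul_def]
  exact Ideal.mul_mem_left _ _ ha

theorem algebraMap_mem_J_pow {c : k⟦X⟧} {m : ℕ} (hc : (X : k⟦X⟧) ^ m ∣ c) :
    algebraMap k⟦X⟧ A c ∈ H.J ^ m := by
  obtain ⟨c, rfl⟩ := hc
  rw [map_mul]
  refine Ideal.mul_mem_right _ _ ?_
  induction m with
  | zero => exact Ideal.mem_pow_zero _ _
  | succ m ih =>
    rw [pow_succ, map_mul]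
    refine Ideal.mul_mem_pow_add H.J ih ?_
    rw [Submodule.pow_one]
    exact H.h_mem

theorem smul_mem_J_pow_of_dvd {c : k⟦X⟧} {m : ℕ} (hc : (X : k⟦X⟧) ^ m ∣ c) (a : A) :
    c • a ∈ H.J ^ m := by
  rw [Algebra.smul_def]
  exact Ideal.mul_mem_right _ _ (H.algebraMap_mem_J_pow hc)

/-- Continuity of a linear form, from the `J`-adic topology to the `h`-adic one. -/
def IsContinuousForm (l : A →ₗ[k⟦X⟧] k⟦X⟧) : Prop :=
  ∀ m : ℕ, ∃ n : ℕ, ∀ a ∈ H.J ^ n, (X : k⟦X⟧) ^ m ∣ l a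

theorem J_pow_le {m n : ℕ} (h : m ≤ n) {a : A} (ha : a ∈ H.J ^ n) : a ∈ H.J ^ m :=
  Ideal.pow_le_pow_right h ha

variable {H}

theorem IsContinuousForm.slice_mem {l : A →ₗ[k⟦X⟧] k⟦X⟧} (hl : H.IsContinuousForm l) (m : ℕ) :
    ∃ n : ℕ, ∀ n' ≥ n, ∀ z ∈ tensorIdeal₂ k⟦X⟧ H.J ^ n', slice l z ∈ H.J ^ m := by
  obtain ⟨n, hn⟩ := hl m
  -- With p + q ≥ n + m, either p ≥ m and x is deep enough, or q ≥ n and l(y) is divisible by h^m.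
  refine ⟨n + m, fun n' hn' z hz => ?_⟩
  have h := tensorIdeal₂_pow_le _ _ _ z hz
  clear hz
  induction h using Submodule.span_induction with
  | mem z hz =>
    obtain ⟨p, q, x, y, hpq, hx, hy, rfl⟩ := hz
    rw [slice_tmul]
    by_cases hp : m ≤ p
    · exact H.smul_mem_J_pow _ (H.J_pow_le hp hx)
    · exact H.smul_mem_J_pow_of_dvd (hn _ (H.J_pow_le (by omega) hy)) _
  | zero => rw [map_zero]; exact zero_mem _
  | add a b _ _ ha hb => rw [map_add]; exact add_mem ha hb
  | smul c a _ ha => rw [map_smul]; exact H.smul_mem_J_pow c ha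

theorem IsContinuousForm.slice₃_mem {l l' : A →ₗ[k⟦X⟧] k⟦X⟧} (hl : H.IsContinuousForm l)
    (hl' : H.IsContinuousForm l') (m : ℕ) :
    ∃ n : ℕ, ∀ n' ≥ n, ∀ z ∈ tensorIdeal₃ k⟦X⟧ H.J ^ n', slice₃ l l' z ∈ H.J ^ m := by
  obtain ⟨n, hn⟩ := hl m
  obtain ⟨n₂, hn₂⟩ := hl' m
  refine ⟨n + n₂ + m, fun n' hn' z hz => ?_⟩
  have h := tensorIdeal₃_pow_le _ _ _ z hz
  clear hz
  induction h using Submodule.span_induction with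
  | mem z hz =>
    obtain ⟨p, q, r, x, y, v, hpq, hx, hy, hv, rfl⟩ := hz
    rw [slice₃_tmul]
    by_cases hp : m ≤ p
    · exact H.smul_mem_J_pow _ (H.J_pow_le hp hx)
    by_cases hq : n ≤ q
    · exact H.smul_mem_J_pow_of_dvd (Dvd.dvd.mul_left (hn _ (H.J_pow_le hq hy)) _) _
    · exact H.smul_mem_J_pow_of_dvd (Dvd.dvd.mul_right (hn₂ _ (H.J_pow_le (by omega) hv)) _) _
  | zero => rw [map_zero]; exact zero_mem _
  | add a b _ _ ha hb => rw [map_add]; exact add_mem ha hb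
  | smul c a _ ha => rw [map_smul]; exact H.smul_mem_J_pow c ha

/-- Slices of successive approximations of Δ(a) form a Cauchy sequence, whose limit exists because A
is complete and is linear in a because A is separated. The threshold n depends on m only, not on a;
this uniformity gives the continuity of the contraction. -/
theorem IsContinuousForm.exists_contract {l : A →ₗ[k⟦X⟧] k⟦X⟧} (hl : H.IsContinuousForm l) :
    ∃ C : A →ₗ[k⟦X⟧] A, ∀ m : ℕ, ∃ n : ℕ, ∀ n' ≥ n, ∀ (a : A) (t : A ⊗[k⟦X⟧] A),
      ApproxAt n' t (H.Δ a) → slice l t - C a ∈ H.J ^ m := by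
  choose N hN using hl.slice_mem
  -- Partial sums replace N by a monotone threshold, so that a better approximation is also a valid
  -- coarser one.
  let N' : ℕ → ℕ := fun m => ∑ i ∈ Finset.range (m + 1), N i
  have hNN' : ∀ m, N m ≤ N' m := fun m =>
    Finset.single_le_sum (f := N) (fun _ _ => Nat.zero_le _) (Finset.self_mem_range_succ m)
  have hN'mono : ∀ m, N' m ≤ N' (m + 1) := fun m => by
    simp only [N', Finset.sum_range_succ _ (m + 1)]
    omega
  have hex : ∀ a : A, ∃ b : A, ∀ m, ∀ n' ≥ N' m, ∀ t : A ⊗[k⟦X⟧] A,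
      ApproxAt n' t (H.Δ a) → slice l t - b ∈ H.J ^ m := by
    intro a
    choose t ht using fun n => exists_approxAt n (H.Δ a)
    obtain ⟨b, hb⟩ := H.adicComplete.complete (fun m => slice l (t (N' m))) fun m => by
      rw [← map_sub]
      exact hN m _ (hNN' m) _ (((ht _).of_le (hN'mono m)).sub_mem (ht _))
    refine ⟨b, fun m n' hn' s hs => ?_⟩
    have h1 : slice l s - slice l (t (N' m)) ∈ H.J ^ m := by
      rw [← map_sub]
      exact hN m _ (hNN' m) _ ((hs.of_le hn').sub_mem (ht _))
    simpa using add_mem h1 (hb m)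
  choose C hC using hex
  refine ⟨{ toFun := C, map_add' := fun a b => ?_, map_smul' := fun c a => ?_ },
    fun m => ⟨N' m, fun n' hn' a t ht => hC a m n' hn' t ht⟩⟩
  · refine H.eq_of_forall_sub_mem fun m => ?_
    obtain ⟨t, ht⟩ := exists_approxAt (N' m) (H.Δ a)
    obtain ⟨s, hs⟩ := exists_approxAt (N' m) (H.Δ b)
    have h := hC (a + b) m _ le_rfl (t + s) (by rw [map_add]; exact ht.add hs)
    have h' := sub_mem (add_mem (hC a m _ le_rfl t ht) (hC b m _ le_rfl s hs)) h
    rw [map_add] at h'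
    convert h' using 1
    abel
  · refine H.eq_of_forall_sub_mem fun m => ?_
    obtain ⟨t, ht⟩ := exists_approxAt (N' m) (H.Δ a)
    have h := hC (c • a) m _ le_rfl (c • t) (by rw [map_smul]; exact ht.smul c)
    have h' := sub_mem (H.smul_mem_J_pow c (hC a m _ le_rfl t ht)) h
    rw [map_smul, smul_sub] at h'
    convert h' using 1
    simp only [RingHom.id_apply]
    abel

variable (H) in
open Classical in
/-- The contraction `a ↦ ∑ l(a'') a'` of the coproduct with a continuous linear form `l` (and
zero if `l` is not continuous). -/
noncomputable def contract (l : A →ₗ[k⟦X⟧] k⟦X⟧) : A →ₗ[k⟦X⟧] A :=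
  if hl : H.IsContinuousForm l then hl.exists_contract.choose else 0

theorem IsContinuousForm.contract_spec {l : A →ₗ[k⟦X⟧] k⟦X⟧} (hl : H.IsContinuousForm l) (m : ℕ) :
    ∃ n : ℕ, ∀ n' ≥ n, ∀ (a : A) (t : A ⊗[k⟦X⟧] A),
      ApproxAt n' t (H.Δ a) → slice l t - H.contract l a ∈ H.J ^ m := by
  unfold contract
  rw [dif_pos hl]
  exact hl.exists_contract.choose_spec m

variable (H) in
-- Δ is multiplicative and sends J into the ideal of A ⊗̂ A, hence J^n into its n-th power.
theorem approxAt_zero_of_mem {n : ℕ} {a : A} (ha : a ∈ H.J ^ n) : ApproxAt n 0 (H.Δ a) := by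
  induction n generalizing a with
  | zero =>
    obtain ⟨t, ht⟩ := exists_approxAt 0 (H.Δ a)
    exact approxAt_of_sub_mem ht (Ideal.mem_pow_zero _ _)
  | succ n ih =>
    rw [Submodule.pow_succ] at ha
    induction ha using Submodule.smul_induction_on' with
    | add x _ y _ hx hy =>
      have := hx.add hy
      rwa [add_zero, ← map_add] at this
    | smul r hr m hm =>
      obtain ⟨t, ht⟩ := exists_approxAt (n + 1) (H.Δ r)
      obtain ⟨s, hs⟩ := exists_approxAt (n + 1) (H.Δ m)
      have h1 := (ht.of_le n.le_succ).sub_mem (ih hr)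
      have h2 := (hs.of_le (Nat.le_add_left 1 n)).sub_mem (H.Δ_continuous m hm)
      rw [sub_zero] at h1 h2
      rw [smul_eq_mul, map_mul]
      refine approxAt_of_sub_mem (ht.mul hs) ?_
      rw [zero_sub]
      exact neg_mem (Ideal.mul_mem_pow_add _ h1 h2)

theorem IsContinuousForm.contract_mem {l : A →ₗ[k⟦X⟧] k⟦X⟧} (hl : H.IsContinuousForm l) (m : ℕ) :
    ∃ n : ℕ, ∀ a ∈ H.J ^ n, H.contract l a ∈ H.J ^ m := by
  obtain ⟨n, hn⟩ := hl.contract_spec m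
  refine ⟨n, fun a ha => ?_⟩
  simpa using hn n le_rfl a 0 (H.approxAt_zero_of_mem ha)

theorem IsContinuousForm.comp_contract {l l' : A →ₗ[k⟦X⟧] k⟦X⟧} (hl : H.IsContinuousForm l)
    (hl' : H.IsContinuousForm l') : H.IsContinuousForm (l.comp (H.contract l')) := by
  intro m
  obtain ⟨n, hn⟩ := hl m
  obtain ⟨n', hn'⟩ := hl'.contract_mem n
  exact ⟨n', fun a ha => hn _ (hn' a ha)⟩

theorem IsContinuousForm.comp_S {l : A →ₗ[k⟦X⟧] k⟦X⟧} (hl : H.IsContinuousForm l) :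
    H.IsContinuousForm (l.comp H.S) := by
  intro m
  obtain ⟨n, hn⟩ := hl m
  exact ⟨n, fun a ha => hn _ (H.S_continuous n a ha)⟩

theorem isContinuousForm_sum {α : Type*} (s : Finset α) {l : α → A →ₗ[k⟦X⟧] k⟦X⟧}
    (hl : ∀ i, H.IsContinuousForm (l i)) : H.IsContinuousForm (∑ i ∈ s, l i) := by
  classical
  intro m
  choose n hn using fun i => hl i m
  refine ⟨∑ i ∈ s, n i, fun a ha => ?_⟩
  rw [LinearMap.sum_apply]
  exact Finset.dvd_sum fun i hi => hn i a (H.J_pow_le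
    (Finset.single_le_sum (f := n) (fun _ _ => Nat.zero_le _) hi) ha)

theorem contract_sum {α : Type*} (s : Finset α) {l : α → A →ₗ[k⟦X⟧] k⟦X⟧}
    (hl : ∀ i, H.IsContinuousForm (l i)) (a : A) :
    H.contract (∑ i ∈ s, l i) a = ∑ i ∈ s, H.contract (l i) a := by
  refine H.eq_of_forall_sub_mem fun m => ?_
  obtain ⟨n, hn⟩ := (isContinuousForm_sum s hl).contract_spec m
  choose n' hn' using fun i => (hl i).contract_spec m
  obtain ⟨t, ht⟩ := exists_approxAt (n + ∑ i ∈ s, n' i) (H.Δ a)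
  have h1 := hn _ (Nat.le_add_right _ _) a t ht
  have h2 : ∑ i ∈ s, (slice (l i) t - H.contract (l i) a) ∈ H.J ^ m :=
    sum_mem fun i hi => hn' i _ ((Finset.single_le_sum (f := n') (fun _ _ => Nat.zero_le _)
      hi).trans (Nat.le_add_left _ _)) a t ht
  have h3 : slice (∑ i ∈ s, l i) t = ∑ i ∈ s, slice (l i) t := by
    clear ht h1 h2
    induction t with
    | zero => simp
    | tmul x y => simp [Finset.sum_smul]
    | add x y hx hy => simp only [map_add, hx, hy, Finset.sum_add_distrib]
  have h4 := sub_mem h2 h1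
  rw [Finset.sum_sub_distrib, h3] at h4
  convert h4 using 1
  abel

/-- Multiplicativity of Δ: a form that expands on products like a matrix coefficient has a
contraction that expands in the same way. This makes `twist` a ring homomorphism. -/
theorem contract_mul {α : Type*} (s : Finset α) {l : A →ₗ[k⟦X⟧] k⟦X⟧}
    {l₁ l₂ : α → A →ₗ[k⟦X⟧] k⟦X⟧} (hl : H.IsContinuousForm l)
    (hl₁ : ∀ i, H.IsContinuousForm (l₁ i)) (hl₂ : ∀ i, H.IsContinuousForm (l₂ i))
    (h : ∀ x y, l (x * y) = ∑ i ∈ s, l₁ i x * l₂ i y) (a b : A) :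
    H.contract l (a * b) = ∑ i ∈ s, H.contract (l₁ i) a * H.contract (l₂ i) b := by
  refine H.eq_of_forall_sub_mem fun m => ?_
  obtain ⟨n, hn⟩ := hl.contract_spec m
  choose n₁ hn₁ using fun i => (hl₁ i).contract_spec m
  choose n₂ hn₂ using fun i => (hl₂ i).contract_spec m
  obtain ⟨t, ht⟩ := exists_approxAt (n + ∑ i ∈ s, (n₁ i + n₂ i)) (H.Δ a)
  obtain ⟨t', ht'⟩ := exists_approxAt (n + ∑ i ∈ s, (n₁ i + n₂ i)) (H.Δ b)
  have h1 := hn _ (Nat.le_add_right _ _) (a * b) (t * t') (by rw [map_mul]; exact ht.mul ht')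
  have h2 : ∑ i ∈ s, (slice (l₁ i) t * slice (l₂ i) t' -
      H.contract (l₁ i) a * H.contract (l₂ i) b) ∈ H.J ^ m := by
    refine sum_mem fun i hi => ?_
    have hle : n₁ i + n₂ i ≤ n + ∑ i ∈ s, (n₁ i + n₂ i) :=
      (Finset.single_le_sum (f := fun i => n₁ i + n₂ i) (fun _ _ => Nat.zero_le _) hi).trans
        (Nat.le_add_left _ _)
    have e1 := hn₁ i _ ((Nat.le_add_right _ _).trans hle) a t ht
    have e2 := hn₂ i _ ((Nat.le_add_left _ _).trans hle) b t' ht'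
    have := add_mem (Ideal.mul_mem_right (slice (l₂ i) t') _ e1)
      (Ideal.mul_mem_left _ (H.contract (l₁ i) a) e2)
    convert this using 1
    noncomm_ring
  have h3 : slice l (t * t') = ∑ i ∈ s, slice (l₁ i) t * slice (l₂ i) t' := by
    clear h1 h2 ht ht'
    induction t with
    | zero => simp
    | add x y hx hy => simp only [add_mul, map_add, hx, hy, Finset.sum_add_distrib]
    | tmul x y =>
      induction t' with
      | zero => simp
      | add x y hx hy => simp only [mul_add, map_add, hx, hy, Finset.sum_add_distrib]
      | tmul x' y' =>
        simp [h, Finset.sum_smul, smul_smul, mul_comm]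
  have h4 := sub_mem h2 h1
  rw [Finset.sum_sub_distrib, h3] at h4
  convert h4 using 1
  abel

theorem IsContinuousForm.contract_one {l : A →ₗ[k⟦X⟧] k⟦X⟧} (hl : H.IsContinuousForm l) :
    H.contract l 1 = algebraMap k⟦X⟧ A (l 1) := by
  refine H.eq_of_forall_sub_mem fun m => ?_
  obtain ⟨n, hn⟩ := hl.contract_spec m
  have h := hn n le_rfl 1 1 (by rw [map_one]; exact approxAt_one n)
  rw [Algebra.TensorProduct.one_def, slice_tmul, ← Algebra.algebraMap_eq_smul_one] at h
  rw [← neg_mem_iff, neg_sub]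
  exact h

theorem contract_counit (hε : H.IsContinuousForm H.ε.toLinearMap) (a : A) :
    H.contract H.ε.toLinearMap a = a := by
  refine H.eq_of_forall_sub_mem fun m => ?_
  obtain ⟨n, hn⟩ := hε.contract_spec m
  obtain ⟨t, ht⟩ := exists_approxAt (n + m) (H.Δ a)
  have h1 := hn _ (Nat.le_add_right _ _) a t ht
  have h2 := H.counit_right a m t (ht.of_le (Nat.le_add_left _ _))
  have h3 := sub_mem h2 h1
  simpa [slice] using h3

/-- ε(∑ l(a'') a') = l(∑ ε(a') a'') = l(a). Applying ε thus recovers a form from its contraction. -/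
theorem counit_contract (hε : H.IsContinuousForm H.ε.toLinearMap) {l : A →ₗ[k⟦X⟧] k⟦X⟧}
    (hl : H.IsContinuousForm l) (a : A) : H.ε (H.contract l a) = l a := by
  refine sub_eq_zero.1 (PowerSeries.eq_zero_of_forall_X_pow_dvd fun m => ?_)
  obtain ⟨n₁, hn₁⟩ := hε m
  obtain ⟨n₂, hn₂⟩ := hl m
  obtain ⟨n, hn⟩ := hl.contract_spec n₁
  obtain ⟨t, ht⟩ := exists_approxAt (n + n₂) (H.Δ a)
  have h1 := hn₁ _ (hn _ (Nat.le_add_right _ _) a t ht)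
  have h2 := hn₂ _ (H.counit_left a n₂ t (ht.of_le (Nat.le_add_left _ _)))
  have h3 : H.ε.toLinearMap (slice l t) =
      l (TensorProduct.lid k⟦X⟧ A (TensorProduct.map H.ε.toLinearMap LinearMap.id t)) := by
    clear ht h1 h2
    induction t with
    | zero => simp
    | add x y hx hy => simp only [map_add, hx, hy]
    | tmul x y => simp [mul_comm]
  rw [map_sub] at h1 h2
  rw [h3] at h1
  have := dvd_sub h2 h1
  simpa using this

/-- Coassociativity for contractions. -/
theorem contract_contract {l l' : A →ₗ[k⟦X⟧] k⟦X⟧} (hl : H.IsContinuousForm l)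
    (hl' : H.IsContinuousForm l') (a : A) :
    H.contract l (H.contract l' a) = H.contract (l.comp (H.contract l')) a := by
  refine H.eq_of_forall_sub_mem fun m => ?_
  obtain ⟨n₁, hn₁⟩ := hl.contract_spec m
  obtain ⟨n₂, hn₂⟩ := hl m
  obtain ⟨n₃, hn₃⟩ := hl'.contract_spec n₂
  obtain ⟨n₄, hn₄⟩ := hl.contract_mem m
  obtain ⟨n₅, hn₅⟩ := hl'.contract_spec n₄
  obtain ⟨n₆, hn₆⟩ := (hl.comp_contract hl').contract_spec m
  obtain ⟨n₇, hn₇⟩ := hl.slice₃_mem hl' m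
  let n := n₁ + n₃ + n₅ + n₆ + n₇
  -- Both sides of the identity are values of `slice₃ l l'`, up to J^m: the left one on a lift of (Δ
  -- ⊗ id)(t), the right one on a lift of (id ⊗ Δ)(t). For t approximating Δ(a) the two lifts agree
  -- modulo the n-th power by coassociativity.
  have hleft : ∀ t : A ⊗[k⟦X⟧] A, ∃ w : A ⊗[k⟦X⟧] (A ⊗[k⟦X⟧] A),
      Ideal.Quotient.mk (tensorIdeal₃ k⟦X⟧ H.J ^ n) w = comulLeft H.Δ n t ∧
      slice₃ l l' w - H.contract l (slice l' t) ∈ H.J ^ m := by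
    intro t
    induction t with
    | zero => exact ⟨0, by simp, by simp⟩
    | add x y hx hy =>
      obtain ⟨w, hw, hw'⟩ := hx
      obtain ⟨v, hv, hv'⟩ := hy
      refine ⟨w + v, by rw [map_add, map_add, hw, hv], ?_⟩
      simp only [map_add]
      convert add_mem hw' hv' using 1
      abel
    | tmul x y =>
      obtain ⟨t, ht⟩ := exists_approxAt n (H.Δ x)
      refine ⟨inc₁₂ _ A t * inc₃ _ A y, ?_, ?_⟩
      · have : inc₁₂Quot k⟦X⟧ H.J n (Ideal.Quotient.mk _ t) = Ideal.Quotient.mk _ (inc₁₂ _ A t) :=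
          rfl
        rw [map_mul, ← this, ht]
        rfl
      · have h1 := hn₁ n (by omega) x t ht
        have h2 : slice₃ l l' (inc₁₂ _ A t * inc₃ _ A y) = l' y • slice l t := by
          clear ht h1
          induction t with
          | zero => simp
          | add x y hx hy => simp only [map_add, add_mul, hx, hy, smul_add]
          | tmul x z => simp [inc₁₂, inc₃, smul_smul]
        rw [h2, slice_tmul, map_smul, ← smul_sub]
        exact H.smul_mem_J_pow _ h1
  have hright : ∀ t : A ⊗[k⟦X⟧] A, ∃ w : A ⊗[k⟦X⟧] (A ⊗[k⟦X⟧] A),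
      Ideal.Quotient.mk (tensorIdeal₃ k⟦X⟧ H.J ^ n) w = comulRight H.Δ n t ∧
      slice₃ l l' w - slice (l.comp (H.contract l')) t ∈ H.J ^ m := by
    intro t
    induction t with
    | zero => exact ⟨0, by simp, by simp⟩
    | add x y hx hy =>
      obtain ⟨w, hw, hw'⟩ := hx
      obtain ⟨v, hv, hv'⟩ := hy
      refine ⟨w + v, by rw [map_add, map_add, hw, hv], ?_⟩
      simp only [map_add]
      convert add_mem hw' hv' using 1
      abel
    | tmul x y =>
      obtain ⟨t, ht⟩ := exists_approxAt n (H.Δ y)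
      refine ⟨inc₁ _ A x * inc₂₃ _ A t, ?_, ?_⟩
      · have : inc₂₃Quot k⟦X⟧ H.J n (Ideal.Quotient.mk _ t) = Ideal.Quotient.mk _ (inc₂₃ _ A t) :=
          rfl
        rw [map_mul, ← this, ht]
        rfl
      · have h1 := hn₂ _ (hn₃ n (by omega) y t ht)
        have h2 : slice₃ l l' (inc₁ _ A x * inc₂₃ _ A t) = l (slice l' t) • x := by
          clear ht h1
          induction t with
          | zero => simp
          | add x y hx hy => simp only [map_add, mul_add, hx, hy, add_smul]
          | tmul x z => simp [inc₁, inc₂₃]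
        rw [h2, slice_tmul, LinearMap.comp_apply, ← sub_smul, ← map_sub]
        exact H.smul_mem_J_pow_of_dvd h1 _
  obtain ⟨t, ht⟩ := exists_approxAt n (H.Δ a)
  obtain ⟨w, hw, hw'⟩ := hleft t
  obtain ⟨v, hv, hv'⟩ := hright t
  have hwv : slice₃ l l' (w - v) ∈ H.J ^ m := by
    refine hn₇ n (by omega) _ (Ideal.Quotient.eq.1 ?_)
    rw [hw, hv]
    exact H.coassoc a n t ht
  have h5 := hn₄ _ (hn₅ n (by omega) a t ht)
  have h6 := hn₆ n (by omega) a t ht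
  rw [map_sub] at h5 hwv
  have := add_mem (add_mem (sub_mem hwv (add_mem h5 hw')) hv') h6
  convert this using 1
  abel

end TopHopfAlgebra

/-! ### Twists by continuous matrix representations -/

namespace TopHopfAlgebra

variable {k A : Type u} [Field k] [Ring A] [Algebra k⟦X⟧ A] {H : TopHopfAlgebra k A}
variable {ι : Type} [Fintype ι] [DecidableEq ι]

/-- The matrix coefficients of a linear map to matrices. -/
noncomputable def coeffForm (r : A →ₗ[k⟦X⟧] Matrix ι ι k⟦X⟧) (i j : ι) : A →ₗ[k⟦X⟧] k⟦X⟧ :=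
  (Matrix.entryLinearMap k⟦X⟧ k⟦X⟧ i j).comp r

@[simp]
theorem coeffForm_apply (r : A →ₗ[k⟦X⟧] Matrix ι ι k⟦X⟧) (i j : ι) (a : A) :
    coeffForm r i j a = r a i j := rfl

variable (H) in
/-- Continuity of all matrix coefficients. -/
def IsContinuousRep (r : A →ₐ[k⟦X⟧] Matrix ι ι k⟦X⟧) : Prop :=
  ∀ i j, H.IsContinuousForm (coeffForm r.toLinearMap i j)

variable {r : A →ₐ[k⟦X⟧] Matrix ι ι k⟦X⟧}

theorem contract_delta (hε : H.IsContinuousForm H.ε.toLinearMap) (l i : ι) (a : A) :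
    H.contract (if l = i then H.ε.toLinearMap else 0) a = if l = i then a else 0 := by
  split_ifs
  · exact contract_counit hε a
  -- The zero form is an empty sum, so its contraction vanishes by additivity.
  · have := contract_sum (H := H) (∅ : Finset ι) (l := fun _ => H.ε.toLinearMap) (fun _ => hε) a
    simpa using this

/-- On approximations of Δ(a), the sum over j is a matrix product and gives r_li(∑ a' S(a'')), which
tends to ε(a) δ_li by the antipode axiom. -/
theorem IsContinuousRep.sum_coeff_antipode (hr : H.IsContinuousRep r) (l i : ι) (a : A) :
    ∑ j, coeffForm r.toLinearMap l j (H.contract ((coeffForm r.toLinearMap j i).comp H.S) a) =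
      if l = i then H.ε a else 0 := by
  refine sub_eq_zero.1 (PowerSeries.eq_zero_of_forall_X_pow_dvd fun m => ?_)
  choose n₁ hn₁ using fun j => hr l j m
  choose n₂ hn₂ using fun j => (hr j i).comp_S.contract_spec (n₁ j)
  obtain ⟨n₃, hn₃⟩ := hr l i m
  obtain ⟨t, ht⟩ := exists_approxAt (n₃ + ∑ j, n₂ j) (H.Δ a)
  have h1 : X ^ m ∣ ∑ j, (coeffForm r.toLinearMap l j) (slice ((coeffForm r.toLinearMap j i).comp H.S) t
      - H.contract ((coeffForm r.toLinearMap j i).comp H.S) a) :=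
    Finset.dvd_sum fun j _ => hn₁ j _ (hn₂ j _ ((Finset.single_le_sum (f := n₂)
      (fun _ _ => Nat.zero_le _) (Finset.mem_univ j)).trans (Nat.le_add_left _ _)) a t ht)
  have h2 := hn₃ _ (H.antipode_right a n₃ t (ht.of_le (Nat.le_add_right _ _)))
  have h3 : ∑ j, (coeffForm r.toLinearMap l j) (slice ((coeffForm r.toLinearMap j i).comp H.S) t) =
      coeffForm r.toLinearMap l i (LinearMap.mul' k⟦X⟧ A (TensorProduct.map LinearMap.id H.S t)) := by
    clear ht h1 h2
    induction t with
    | zero => simp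
    | add x y hx hy => simp only [map_add, Finset.sum_add_distrib, hx, hy]
    | tmul x y => simp [Matrix.mul_apply, mul_comm]
  have h4 : coeffForm r.toLinearMap l i (algebraMap k⟦X⟧ A (H.ε a)) =
      if l = i then H.ε a else 0 := by
    simp [Matrix.algebraMap_matrix_apply]
  rw [map_sub, h4] at h2
  simp only [map_sub, Finset.sum_sub_distrib, h3] at h1
  have := dvd_sub h2 h1
  rwa [sub_sub_sub_cancel_left] at this

/-- The same computation with ∑ S(a') a''. -/
theorem IsContinuousRep.sum_antipode_coeff (hr : H.IsContinuousRep r) (l i : ι) (a : A) :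
    ∑ j, coeffForm r.toLinearMap l j (H.S (H.contract (coeffForm r.toLinearMap j i) a)) =
      if l = i then H.ε a else 0 := by
  refine sub_eq_zero.1 (PowerSeries.eq_zero_of_forall_X_pow_dvd fun m => ?_)
  choose n₁ hn₁ using fun j => (hr l j).comp_S m
  choose n₂ hn₂ using fun j => (hr j i).contract_spec (n₁ j)
  obtain ⟨n₃, hn₃⟩ := hr l i m
  obtain ⟨t, ht⟩ := exists_approxAt (n₃ + ∑ j, n₂ j) (H.Δ a)
  have h1 : X ^ m ∣ ∑ j, (coeffForm r.toLinearMap l j) (H.S (slice (coeffForm r.toLinearMap j i) t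
      - H.contract (coeffForm r.toLinearMap j i) a)) :=
    Finset.dvd_sum fun j _ => hn₁ j _ (hn₂ j _ ((Finset.single_le_sum (f := n₂)
      (fun _ _ => Nat.zero_le _) (Finset.mem_univ j)).trans (Nat.le_add_left _ _)) a t ht)
  have h2 := hn₃ _ (H.antipode_left a n₃ t (ht.of_le (Nat.le_add_right _ _)))
  have h3 : ∑ j, (coeffForm r.toLinearMap l j) (H.S (slice (coeffForm r.toLinearMap j i) t)) =
      coeffForm r.toLinearMap l i (LinearMap.mul' k⟦X⟧ A (TensorProduct.map H.S LinearMap.id t)) := by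
    clear ht h1 h2
    induction t with
    | zero => simp
    | add x y hx hy => simp only [map_add, Finset.sum_add_distrib, hx, hy]
    | tmul x y => simp [Matrix.mul_apply, mul_comm]
  have h4 : coeffForm r.toLinearMap l i (algebraMap k⟦X⟧ A (H.ε a)) =
      if l = i then H.ε a else 0 := by
    simp [Matrix.algebraMap_matrix_apply]
  rw [map_sub, h4] at h2
  simp only [map_sub, Finset.sum_sub_distrib, h3] at h1
  have := dvd_sub h2 h1
  rwa [sub_sub_sub_cancel_left] at this

/-- By coassociativity the composite contractions add up to the contraction with the form ∑_j r_lj(∑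
r_ji(S a'') a') = δ_li ε, and contraction with ε is the identity. With the next lemma, this says
that the operator matrices of r and of r ∘ S are mutually inverse. -/
theorem IsContinuousRep.sum_contract_antipode (hε : H.IsContinuousForm H.ε.toLinearMap)
    (hr : H.IsContinuousRep r) (l i : ι) (a : A) :
    ∑ j, H.contract (coeffForm r.toLinearMap l j)
      (H.contract ((coeffForm r.toLinearMap j i).comp H.S) a) = if l = i then a else 0 := by
  rw [← contract_delta hε l i a]
  simp only [fun j => contract_contract (hr l j) (hr j i).comp_S a]
  rw [← contract_sum _ (fun j => (hr l j).comp_contract (hr j i).comp_S)]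
  congr 2
  refine LinearMap.ext fun b => ?_
  rw [LinearMap.sum_apply]
  refine (hr.sum_coeff_antipode l i b).trans ?_
  split_ifs <;> rfl

theorem IsContinuousRep.sum_antipode_contract (hε : H.IsContinuousForm H.ε.toLinearMap)
    (hr : H.IsContinuousRep r) (l i : ι) (a : A) :
    ∑ j, H.contract ((coeffForm r.toLinearMap l j).comp H.S)
      (H.contract (coeffForm r.toLinearMap j i) a) = if l = i then a else 0 := by
  rw [← contract_delta hε l i a]
  simp only [fun j => contract_contract (hr l j).comp_S (hr j i) a]
  rw [← contract_sum _ (fun j => (hr l j).comp_S.comp_contract (hr j i))]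
  congr 2
  refine LinearMap.ext fun b => ?_
  rw [LinearMap.sum_apply]
  refine (hr.sum_antipode_coeff l i b).trans ?_
  split_ifs <;> rfl

theorem IsContinuousRep.contract_coeff_mul (hr : H.IsContinuousRep r) (i j : ι) (x y : A) :
    H.contract (coeffForm r.toLinearMap i j) (x * y) =
      ∑ m, H.contract (coeffForm r.toLinearMap i m) x *
        H.contract (coeffForm r.toLinearMap m j) y :=
  contract_mul _ (hr i j) (fun m => hr i m) (fun m => hr m j)
    (fun a b => by simp [Matrix.mul_apply]) x y

/-- The antipode is antimultiplicative in every continuous representation. -/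
theorem IsContinuousRep.contract_antipode_mul (hε : H.IsContinuousForm H.ε.toLinearMap)
    (hr : H.IsContinuousRep r) (i j : ι) (x y : A) :
    H.contract ((coeffForm r.toLinearMap i j).comp H.S) (x * y) =
      ∑ m, H.contract ((coeffForm r.toLinearMap m j).comp H.S) x *
        H.contract ((coeffForm r.toLinearMap i m).comp H.S) y := by
  set s : ι → ι → A →ₗ[k⟦X⟧] A := fun i j => H.contract ((coeffForm r.toLinearMap i j).comp H.S)
  set q : ι → ι → A →ₗ[k⟦X⟧] A := fun i j => H.contract (coeffForm r.toLinearMap i j)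
  have hqs : ∀ l i a, ∑ j, q l j (s j i a) = if l = i then a else 0 := fun l i a =>
    hr.sum_contract_antipode hε l i a
  have hsq : ∀ l i a, ∑ j, s l j (q j i a) = if l = i then a else 0 := fun l i a =>
    hr.sum_antipode_contract hε l i a
  -- Antimultiplicativity of S is not an axiom; it follows from uniqueness of inverses. Applying the
  -- matrix q to the candidate Y gives xy in position j and 0 elsewhere, and applying its inverse s
  -- recovers Y.
  let Y : ι → A := fun i => ∑ m, s m j x * s i m y
  have h1 : ∀ l, ∑ i, q l i (Y i) = if l = j then x * y else 0 := by
    intro l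
    have e1 : ∀ i, q l i (Y i) = ∑ n, ∑ m, q l n (s m j x) * q n i (s i m y) := fun i => by
      simp only [Y, map_sum]
      rw [Finset.sum_comm]
      exact Finset.sum_congr rfl fun m _ => hr.contract_coeff_mul l i _ _
    simp only [e1]
    rw [Finset.sum_comm]
    have e2 : ∀ n, ∑ i, ∑ m, q l n (s m j x) * q n i (s i m y) = q l n (s n j x) * y := fun n => by
      rw [Finset.sum_comm]
      simp only [← Finset.mul_sum, hqs]
      simp
    simp only [e2]
    rw [← Finset.sum_mul, hqs]
    split_ifs <;> simp
  have h2 : ∑ l, s i l (∑ i, q l i (Y i)) = Y i := by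
    simp only [map_sum]
    rw [Finset.sum_comm]
    simp [hsq]
  change _ = Y i
  rw [← h2]
  simp only [h1]
  rw [Finset.sum_eq_single j (fun l _ hl => by rw [if_neg hl, map_zero]) (by simp), if_pos rfl]

/-- The dual representation: the transpose of `r ∘ S`. -/
noncomputable def dualRep (hε : H.IsContinuousForm H.ε.toLinearMap) (hr : H.IsContinuousRep r) :
    A →ₐ[k⟦X⟧] Matrix ι ι k⟦X⟧ :=
  AlgHom.ofLinearMap
    ((Matrix.transposeLinearEquiv ι ι k⟦X⟧ k⟦X⟧).toLinearMap.comp (r.toLinearMap.comp H.S))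
    (by
      refine Matrix.ext fun i j => ?_
      have h := hr.sum_coeff_antipode j i 1
      simp only [fun j => (hr j i).comp_S.contract_one] at h
      simpa [Matrix.algebraMap_matrix_apply, Matrix.one_apply, eq_comm] using h)
    (fun x y => by
      refine Matrix.ext fun i j => ?_
      -- Applying ε turns the identity between contractions into one between the forms themselves.
      have h := congrArg H.ε (hr.contract_antipode_mul hε j i x y)
      simp only [map_sum, map_mul, counit_contract hε (hr _ _).comp_S] at h
      simpa [Matrix.mul_apply] using h)

@[simp]
theorem dualRep_apply (hε : H.IsContinuousForm H.ε.toLinearMap) (hr : H.IsContinuousRep r)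
    (a : A) (i j : ι) : dualRep hε hr a i j = r (H.S a) j i := rfl

theorem IsContinuousRep.dualRep (hε : H.IsContinuousForm H.ε.toLinearMap)
    (hr : H.IsContinuousRep r) : H.IsContinuousRep (dualRep hε hr) :=
  fun i j => (hr j i).comp_S

/-- The homomorphism `A → A ⊗ End(V)` obtained from the coproduct and a representation on `V`. -/
noncomputable def twist (hr : H.IsContinuousRep r) : A →+* Matrix ι ι A where
  toFun a := Matrix.of fun i j => H.contract (coeffForm r.toLinearMap i j) a
  map_one' := by
    ext i j
    rw [Matrix.of_apply, (hr i j).contract_one]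
    simp [Matrix.one_apply, apply_ite (algebraMap k⟦X⟧ A)]
  map_mul' x y := by
    ext i j
    exact hr.contract_coeff_mul i j x y
  map_zero' := by
    ext i j
    simp
  map_add' x y := by
    ext i j
    simp

theorem twist_apply (hr : H.IsContinuousRep r) (a : A) (i j : ι) :
    twist hr a i j = H.contract (coeffForm r.toLinearMap i j) a := rfl

theorem counit_twist (hε : H.IsContinuousForm H.ε.toLinearMap) (hr : H.IsContinuousRep r) (a : A)
    (i j : ι) : H.ε (twist hr a i j) = r a i j :=
  counit_contract hε (hr i j) a

theorem isDualTwist (hε : H.IsContinuousForm H.ε.toLinearMap) (hr : H.IsContinuousRep r) :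
    IsDualTwist (twist hr) (twist (hr.dualRep hε)) where
  left a l i := hr.sum_contract_antipode hε l i a
  right a l i := hr.sum_antipode_contract hε l i a

end TopHopfAlgebra

/-! ### Complete torsion-free modules over `k[[h]]` -/

section HComplete

variable {k : Type*} [Field k]

/-- A `k[[h]]`-module without `h`-torsion, in which all series `∑ h ^ i f_i` have a unique sum: the
tails `g_n` of the series are determined by `g_n = f_n + h g_{n+1}`. -/
structure IsHComplete (k : Type*) [Field k] (C : Type*) [AddCommGroup C] [Module k⟦X⟧ C] :
    Prop where
  torsionFree : ∀ c : C, (X : k⟦X⟧) • c = 0 → c = 0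
  separated : ∀ f : ℕ → C, (∀ n, f n = (X : k⟦X⟧) • f (n + 1)) → ∀ n, f n = 0
  complete : ∀ f : ℕ → C, ∃ g : ℕ → C, ∀ n, g n = f n + (X : k⟦X⟧) • g (n + 1)

theorem IsHComplete.smul_cancel {C : Type*} [AddCommGroup C] [Module k⟦X⟧ C]
    (hC : IsHComplete k C) {c c' : C} (h : (X : k⟦X⟧) • c = (X : k⟦X⟧) • c') : c = c' :=
  sub_eq_zero.1 (hC.torsionFree _ (by rw [smul_sub, h, sub_self]))

/-- Successive approximation. -/
theorem IsHComplete.mem_range_of_approx {C C' : Type*} [AddCommGroup C] [Module k⟦X⟧ C]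
    [AddCommGroup C'] [Module k⟦X⟧ C'] (hC : IsHComplete k C) (hC' : IsHComplete k C')
    (D : C →ₗ[k⟦X⟧] C') (Z : Set C')
    (hZ : ∀ z ∈ Z, ∃ c, ∃ z' ∈ Z, z = D c + (X : k⟦X⟧) • z') :
    ∀ z ∈ Z, ∃ c, D c = z := by
  intro z hz
  choose! c z' hz' hcz using hZ
  let s : ℕ → C' := fun n => z'^[n] z
  have hs : ∀ n, s n ∈ Z := fun n => by
    induction n with
    | zero => exact hz
    | succ n ih =>
      simp only [s, Function.iterate_succ_apply']
      exact hz' _ ih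
  -- The remainders satisfy s_n = D(c(s_n)) + h s_{n+1}, so the preimage is g_0 = ∑ h^i c(s_i). The
  -- errors D(g_n) - s_n are each h times the next one, hence zero.
  obtain ⟨g, hg⟩ := hC.complete fun n => c (s n)
  refine ⟨g 0, ?_⟩
  have := hC'.separated (fun n => D (g n) - s n) (fun n => by
    have h1 := hcz (s n) (hs n)
    have h2 : z' (s n) = s (n + 1) := (Function.iterate_succ_apply' z' n z).symm
    rw [h2] at h1
    rw [hg n, map_add, map_smul, smul_sub]
    nth_rw 2 [h1]
    abel) 0
  exact sub_eq_zero.1 this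

theorem IsHComplete.prod {C C' : Type*} [AddCommGroup C] [Module k⟦X⟧ C]
    [AddCommGroup C'] [Module k⟦X⟧ C'] (hC : IsHComplete k C) (hC' : IsHComplete k C') :
    IsHComplete k (C × C') where
  torsionFree c hc := Prod.ext (hC.torsionFree _ (congrArg Prod.fst hc))
    (hC'.torsionFree _ (congrArg Prod.snd hc))
  separated f hf n := Prod.ext (hC.separated (fun n => (f n).1) (fun n => congrArg Prod.fst (hf n)) n)
    (hC'.separated (fun n => (f n).2) (fun n => congrArg Prod.snd (hf n)) n)
  complete f := by
    obtain ⟨g, hg⟩ := hC.complete fun n => (f n).1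
    obtain ⟨g', hg'⟩ := hC'.complete fun n => (f n).2
    exact ⟨fun n => (g n, g' n), fun n => Prod.ext (hg n) (hg' n)⟩

theorem isHComplete_of_equiv {B C : Type*} [Ring B] [AddCommGroup C] [Module k⟦X⟧ C]
    (e : C ≃+ B⟦X⟧) (he : ∀ c, e ((X : k⟦X⟧) • c) = X * e c) : IsHComplete k C where
  torsionFree c hc := by
    have h := he c
    rw [hc, map_zero] at h
    refine e.injective (PowerSeries.ext fun n => ?_)
    have := congrArg (coeff (n + 1)) h
    rw [coeff_succ_X_mul] at this
    simpa using this.symm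
  separated f hf := by
    have key : ∀ m n, coeff m (e (f n)) = 0 := by
      intro m
      induction m with
      | zero => intro n; rw [hf n, he]; simp
      | succ m ih => intro n; rw [hf n, he, coeff_succ_X_mul, ih]
    intro n
    refine e.injective (PowerSeries.ext fun m => ?_)
    rw [key, map_zero, map_zero]
  complete f := by
    -- The tail from n on is ∑ h^i f_{n+i}; its m-th coefficient involves only i ≤ m.
    refine ⟨fun n => e.symm (PowerSeries.mk fun m => ∑ i ∈ Finset.range (m + 1),
      coeff (m - i) (e (f (n + i)))), fun n => ?_⟩
    refine e.injective (PowerSeries.ext fun m => ?_)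
    rw [map_add, he, e.apply_symm_apply, e.apply_symm_apply, coeff_mk, map_add]
    cases m with
    | zero => simp
    | succ m =>
      rw [coeff_succ_X_mul, coeff_mk, Finset.sum_range_succ', add_comm]
      simp only [Nat.sub_zero, Nat.add_zero, Nat.add_sub_add_right]
      congr 1
      refine Finset.sum_congr rfl fun i _ => ?_
      rw [add_assoc, add_comm 1 i]

theorem isHComplete_self : IsHComplete k k⟦X⟧ :=
  isHComplete_of_equiv (AddEquiv.refl _) fun _ => rfl

theorem IsDeformation.isHComplete {A A₀ : Type*} [Ring A] [Algebra k⟦X⟧ A] [Ring A₀]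
    [Algebra k A₀] {π : A →+* A₀} (hπ : IsDeformation (k := k) π) : IsHComplete k A := by
  obtain ⟨e, he⟩ := hπ.topologicallyFree
  exact isHComplete_of_equiv e fun c => by rw [he, PowerSeries.map_X]

/-- Series of linear maps are summed pointwise, and the sums are linear because sums in A are
unique. No finiteness of N is needed. -/
theorem IsHComplete.linearMap {A : Type*} [Ring A] [Algebra k⟦X⟧ A] (hA : IsHComplete k A)
    (N : Type*) [AddCommGroup N] [Module A N] : IsHComplete k (N →ₗ[A] A) where
  torsionFree c hc := LinearMap.ext fun n => hA.torsionFree _ (LinearMap.congr_fun hc n)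
  separated f hf n := LinearMap.ext fun x =>
    hA.separated (fun n => f n x) (fun n => LinearMap.congr_fun (hf n) x) n
  complete f := by
    choose g hg using fun x : N => hA.complete fun n => f n x
    refine ⟨fun n =>
      { toFun := fun x => g x n
        map_add' := fun x y => ?_
        map_smul' := fun a x => ?_ }, fun n => LinearMap.ext fun x => hg x n⟩
    · refine sub_eq_zero.1 (hA.separated (fun n => g (x + y) n - (g x n + g y n)) (fun n => ?_) n)
      simp only [hg _ n, map_add, smul_add, smul_sub]
      abel
    · refine sub_eq_zero.1 (hA.separated (fun n => g (a • x) n - a • g x n) (fun n => ?_) n)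
      simp only [hg _ n, map_smul, smul_add, smul_sub, smul_comm a (X : k⟦X⟧)]
      abel

end HComplete

/-! ### Reduction modulo `h` -/

section Reduction

variable {k A A₀ : Type u} [Field k] [Ring A] [Algebra k⟦X⟧ A] [Ring A₀] [Algebra k A₀]

variable (k A) in
/-- The central element `h` of `A`. -/
noncomputable def hElem : A := algebraMap k⟦X⟧ A X

theorem hElem_mul (a : A) : hElem k A * a = (X : k⟦X⟧) • a := (Algebra.smul_def _ _).symm

theorem smul_hElem_smul {N : Type*} [AddCommGroup N] [Module A N] (a : A) (n : N) :
    a • hElem k A • n = hElem k A • a • n := by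
  rw [smul_smul, smul_smul]
  congr 1
  exact (Algebra.commutes (X : k⟦X⟧) a).symm

variable (k A) in
/-- The submodule `h N` of an `A`-module `N`. -/
noncomputable def hSubmodule (N : Type*) [AddCommGroup N] [Module A N] : Submodule A N where
  carrier := {n | ∃ m, hElem k A • m = n}
  add_mem' := by
    rintro _ _ ⟨m, rfl⟩ ⟨m', rfl⟩
    exact ⟨m + m', smul_add _ _ _⟩
  zero_mem' := ⟨0, smul_zero _⟩
  smul_mem' := by
    rintro a _ ⟨m, rfl⟩
    exact ⟨a • m, (smul_hElem_smul a m).symm⟩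

variable {π : A →+* A₀}

/-- The `A₀`-module `N / h N`. -/
def Reduction (_ : IsDeformation (k := k) π) (N : Type*) [AddCommGroup N] [Module A N] : Type _ :=
  N ⧸ hSubmodule k A N

namespace Reduction

variable {hπ : IsDeformation (k := k) π} {N N' : Type*} [AddCommGroup N] [Module A N]
  [AddCommGroup N'] [Module A N']

noncomputable instance : AddCommGroup (Reduction hπ N) := inferInstanceAs (AddCommGroup (N ⧸ hSubmodule k A N))

variable (hπ) in
/-- The class of an element modulo `h`. -/
noncomputable def mk : N →+ Reduction hπ N := (hSubmodule k A N).mkQ.toAddMonoidHom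

theorem mk_surjective : Function.Surjective (mk hπ (N := N)) := Submodule.mkQ_surjective _

theorem mk_eq_zero {n : N} : mk hπ n = 0 ↔ ∃ m, hElem k A • m = n :=
  Submodule.Quotient.mk_eq_zero _

theorem mk_smul_eq_of_map_eq {a b : A} (h : π a = π b) (n : N) : mk hπ (a • n) = mk hπ (b • n) := by
  rw [← sub_eq_zero, ← map_sub, mk_eq_zero, ← sub_smul]
  obtain ⟨c, hc⟩ := (hπ.ker_eq (a - b)).1 (by rw [map_sub, h, sub_self])
  exact ⟨c • n, by rw [smul_smul, hElem_mul, hc]⟩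

/-- The chosen lift along π is immaterial, since ker π = hA acts by zero on N/hN; see `map_smul_mk`.
-/
noncomputable instance : SMul A₀ (Reduction hπ N) where
  smul c x := (show Reduction hπ N from
    (Function.surjInv hπ.surjective c • (show N ⧸ hSubmodule k A N from x) : N ⧸ hSubmodule k A N))

theorem map_smul_mk (a : A) (n : N) : π a • mk hπ n = mk hπ (a • n) :=
  mk_smul_eq_of_map_eq (Function.surjInv_eq hπ.surjective (π a)) n

noncomputable instance : Module A₀ (Reduction hπ N) :=
  letI : Module A (Reduction hπ N) := inferInstanceAs (Module A (N ⧸ hSubmodule k A N))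
  Function.Surjective.moduleLeft π hπ.surjective fun a x => by
    obtain ⟨n, rfl⟩ := mk_surjective x
    exact map_smul_mk a n

/-- A semilinear map into an `A₀`-module factors through the reduction. -/
noncomputable def lift {M : Type*} [AddCommGroup M] [Module A₀ M] (f : N →+ M)
    (hf : ∀ a n, f (a • n) = π a • f n) : Reduction hπ N →ₗ[A₀] M where
  toFun := QuotientAddGroup.lift (hSubmodule k A N).toAddSubgroup f (by
    rintro _ ⟨m, rfl⟩
    have : π (hElem k A) = 0 := (hπ.ker_eq _).2 ⟨1, by rw [← hElem_mul, mul_one]⟩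
    exact (hf _ _).trans (by rw [this, zero_smul]))
  map_add' := map_add _
  map_smul' c x := by
    obtain ⟨a, rfl⟩ := hπ.surjective c
    obtain ⟨n, rfl⟩ := mk_surjective x
    rw [map_smul_mk]
    exact hf a n

theorem hom_ext {M : Type*} [AddCommGroup M] [Module A₀ M] {f g : Reduction hπ N →ₗ[A₀] M}
    (h : ∀ n, f (mk hπ n) = g (mk hπ n)) : f = g := by
  refine LinearMap.ext fun x => ?_
  obtain ⟨n, rfl⟩ := mk_surjective x
  exact h n

variable (hπ) in
/-- Functoriality of the reduction. -/
noncomputable def map (f : N →ₗ[A] N') : Reduction hπ N →ₗ[A₀] Reduction hπ N' :=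
  lift ((mk hπ).comp f.toAddMonoidHom) fun a n => by
    change mk hπ (f (a • n)) = π a • mk hπ (f n)
    rw [map_smul, map_smul_mk]

end Reduction

/-- The functor `N ↦ N / h N`. -/
noncomputable def reductionFunctor (hπ : IsDeformation (k := k) π) :
    ModuleCat.{u} A ⥤ ModuleCat.{u} A₀ where
  obj N := ModuleCat.of A₀ (Reduction hπ N)
  map f := ModuleCat.ofHom (Reduction.map hπ f.hom)
  map_id N := ModuleCat.hom_ext (Reduction.hom_ext fun n => rfl)
  map_comp f g := ModuleCat.hom_ext (Reduction.hom_ext fun n => rfl)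

instance (hπ : IsDeformation (k := k) π) : (reductionFunctor hπ).Additive where
  map_add {M N f g} := ModuleCat.hom_ext (Reduction.hom_ext fun n => rfl)

/-- The reduction functor is left adjoint to the restriction of scalars. -/
noncomputable def reductionAdjunction (hπ : IsDeformation (k := k) π) :
    reductionFunctor hπ ⊣ ModuleCat.restrictScalars.{u} π :=
  Adjunction.mkOfHomEquiv
    { homEquiv := fun _ M =>
        { toFun := fun f => ModuleCat.ofHom (Y := (ModuleCat.restrictScalars π).obj M)
            { toFun := fun n => f.hom (Reduction.mk hπ n)
              map_add' := fun x y => by rw [map_add]; exact map_add f.hom _ _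
              map_smul' := fun a x => by
                rw [← Reduction.map_smul_mk]
                exact map_smul f.hom _ _ }
          invFun := fun g => ModuleCat.ofHom
            (Reduction.lift (M := M) (hπ := hπ) g.hom.toAddMonoidHom fun a n => g.hom.map_smul a n)
          left_inv := fun f => ModuleCat.hom_ext (Reduction.hom_ext fun n => rfl)
          right_inv := fun g => rfl }
      homEquiv_naturality_left_symm := fun f g =>
        ModuleCat.hom_ext (Reduction.hom_ext fun n => rfl)
      homEquiv_naturality_right := fun f g => rfl }

/-- Reduction is left adjoint to restriction of scalars, which preserves epimorphisms. -/
theorem projective_reductionFunctor (hπ : IsDeformation (k := k) π) {N : ModuleCat.{u} A}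
    (hN : Projective N) : Projective ((reductionFunctor hπ).obj N) :=
  (reductionAdjunction hπ).map_projective N hN

/-- A projective module embeds in a free one, and A has no h-torsion. -/
theorem hElem_smul_eq_zero (hA : IsHComplete k A) {N : ModuleCat.{u} A} (hN : Projective N) {n : N}
    (hn : hElem k A • n = 0) : n = 0 := by
  have : Module.Projective A N := (IsProjective.iff_projective (R := A) N).2 hN
  obtain ⟨s, hs⟩ := Module.projective_def'.1 this
  have h1 : s n = 0 := Finsupp.ext fun i => hA.torsionFree _ (by
    have := congrArg (fun f => f i) (s.map_smul (hElem k A) n)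
    simp only [hn, map_zero, Finsupp.smul_apply, smul_eq_mul, hElem_mul] at this
    exact this.symm)
  have h2 := LinearMap.congr_fun hs n
  rw [LinearMap.comp_apply, h1, map_zero] at h2
  exact h2.symm

variable (H : TopHopfAlgebra k A)

/-- The reduction modulo `h` of a linear map to `K`. -/
noncomputable def reductionAug (hπ : IsDeformation (k := k) π) (ε₀ : A₀ →ₐ[k] k)
    (hε₀ : ∀ a : A, ε₀ (π a) = PowerSeries.constantCoeff (H.ε a))
    {N : Type*} [AddCommGroup N] [Module A N] (f : N →ₗ[A] augModule H.ε.toRingHom) :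
    Reduction hπ N →ₗ[A₀] augModule ε₀.toRingHom :=
  Reduction.lift (M := augModule ε₀.toRingHom)
    ((PowerSeries.constantCoeff (R := k)).toAddMonoidHom.comp f.toAddMonoidHom) (fun a n => by
      change PowerSeries.constantCoeff (show k⟦X⟧ from f (a • n)) =
        ε₀ (π a) * PowerSeries.constantCoeff (show k⟦X⟧ from f n)
      rw [map_smul, hε₀, ← map_mul]
      rfl)

theorem hElem_smul_augModule (c : augModule H.ε.toRingHom) :
    hElem k A • c = (X * (show k⟦X⟧ from c) : k⟦X⟧) := by
  change H.ε (algebraMap k⟦X⟧ A X) * (show k⟦X⟧ from c) = _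
  rw [AlgHom.commutes]
  rfl

/-- The reduction modulo `h` of a projective resolution of `K` is a projective resolution
of `k`. -/
noncomputable def reductionResolution (hπ : IsDeformation (k := k) π) (ε₀ : A₀ →ₐ[k] k)
    (hε₀ : ∀ a : A, ε₀ (π a) = PowerSeries.constantCoeff (H.ε a))
    (P : ProjectiveResolution (augModule H.ε.toRingHom)) :
    ProjectiveResolution (augModule ε₀.toRingHom) :=
  let f : P.complex.X 0 →ₗ[A] augModule H.ε.toRingHom := (P.π.f 0).hom
  have aug_d : ∀ y, f (P.complex.d 1 0 y) = 0 := fun y =>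
    congrArg (fun g => g.hom y) P.complex_d_comp_π_f_zero
  have d_d : ∀ n y, P.complex.d (n + 1) n (P.complex.d (n + 2) (n + 1) y) = 0 := fun n y => by
    rw [← ModuleCat.comp_apply, HomologicalComplex.d_comp_d]
    rfl
  have surj : Function.Surjective f := (ModuleCat.epi_iff_surjective _).1 inferInstance
  have exact_aug : ∀ x, f x = 0 → ∃ y, P.complex.d 1 0 y = x := P.exact_zero_apply
  have cancel : ∀ c : augModule H.ε.toRingHom, hElem k A • c = 0 → c = 0 := fun c hc =>
    isHComplete_self.torsionFree (show k⟦X⟧ from c) ((hElem_smul_augModule H c).symm.trans hc)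
  have exact_d : ∀ n x', P.complex.d (n + 1) n (hElem k A • x') = 0 →
      ∃ y, P.complex.d (n + 2) (n + 1) y = x' := fun n x' h =>
    P.exact_succ_apply n x' (hElem_smul_eq_zero hπ.isHComplete (P.projective n)
      (by rw [← map_smul, h]))
  ProjectiveResolution.ofExact
    (((reductionFunctor hπ).mapHomologicalComplex _).obj P.complex)
    (fun n => projective_reductionFunctor hπ (P.projective n))
    (ModuleCat.ofHom (Y := augModule ε₀.toRingHom)
      (reductionAug H hπ ε₀ hε₀ f))
    (ModuleCat.hom_ext (Reduction.hom_ext fun n => by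
      change PowerSeries.constantCoeff (show k⟦X⟧ from f (P.complex.d 1 0 n)) = 0
      rw [aug_d]
      exact map_zero (PowerSeries.constantCoeff (R := k))))
    (by
      intro c
      obtain ⟨n, hn⟩ := surj (PowerSeries.C (R := k) c : k⟦X⟧)
      refine ⟨Reduction.mk hπ n, ?_⟩
      change PowerSeries.constantCoeff (show k⟦X⟧ from f n) = c
      rw [hn]
      exact PowerSeries.constantCoeff_C (R := k) c)
    (by
      intro x hx
      obtain ⟨n, rfl⟩ := Reduction.mk_surjective (hπ := hπ) (N := P.complex.X 0) x
      change PowerSeries.constantCoeff (show k⟦X⟧ from f n) = 0 at hx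
      obtain ⟨c, hc⟩ := PowerSeries.X_dvd_iff.2 hx
      obtain ⟨n', hn'⟩ := surj c
      -- The augmentation of n is h c; subtracting h n', with n' over c, leaves an element of the
      -- kernel without changing the class modulo h.
      obtain ⟨y, hy⟩ := exact_aug (n - hElem k A • n') (by
        rw [map_sub, map_smul, hn']
        exact sub_eq_zero.2 (hc.trans (hElem_smul_augModule H c).symm))
      refine ⟨Reduction.mk hπ y, ?_⟩
      change Reduction.mk hπ (P.complex.d 1 0 y) = _
      rw [hy, map_sub, sub_eq_self, Reduction.mk_eq_zero]
      exact ⟨n', rfl⟩)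
    (by
      intro n x hx
      obtain ⟨x, rfl⟩ := Reduction.mk_surjective (hπ := hπ) (N := P.complex.X (n + 1)) x
      change Reduction.mk hπ (P.complex.d (n + 1) n x) = 0 at hx
      rw [Reduction.mk_eq_zero] at hx
      obtain ⟨x', hx'⟩ := hx
      -- From d x = h x' and the absence of h-torsion (in K for n = 0, in the preceding term of P
      -- otherwise), x' is itself a cycle, hence some d y. Then x - h y is a cycle with the same
      -- class as x.
      obtain ⟨y, rfl⟩ : ∃ y, P.complex.d (n + 1) n y = x' := by
        cases n with
        | zero =>
          refine exact_aug x' (cancel _ ?_)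
          rw [← map_smul, hx', aug_d]
        | succ n => exact exact_d n x' (by rw [hx', d_d])
      obtain ⟨w, hw⟩ := P.exact_succ_apply n (x - hElem k A • y) (by
        rw [map_sub, map_smul, hx', sub_self])
      refine ⟨Reduction.mk hπ w, ?_⟩
      change Reduction.mk hπ (P.complex.d (n + 2) (n + 1) w) = _
      rw [hw, map_sub, sub_eq_self, Reduction.mk_eq_zero]
      exact ⟨y, rfl⟩)

end Reduction

/-! ### Cohomology of the dual complex in terms of linear forms -/

section LinearForms

variable {R : Type u} [Ring R]

/-- In degree 0 the default value of `prev` is 0 and the differential there is zero, so the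
criterion correctly says that every cocycle vanishes. -/
theorem subsingleton_extToRing_iff {M : ModuleCat.{u} R} (P : ProjectiveResolution M) (i : ℕ) :
    Subsingleton (extToRing R i M) ↔ ∀ ψ : P.complex.X i →ₗ[R] R,
      ψ.comp (P.complex.d (i + 1) i).hom = 0 → ∃ χ : P.complex.X ((ComplexShape.up ℕ).prev i) →ₗ[R] R,
        χ.comp (P.complex.d i ((ComplexShape.up ℕ).prev i)).hom = ψ := by
  have h1 : Subsingleton (extToRing R i M) ↔ Subsingleton ((homComplex P.complex).homology i) :=
    (extToRingIso P i).toLinearEquiv.toEquiv.subsingleton_congr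
  have h2 : (ComplexShape.up ℕ).next i = i + 1 := by simp
  rw [h1, subsingleton_homology_iff, h2]
  rfl

end LinearForms

/-! ### Linear forms modulo h -/

section ReduceHom

variable {k A A₀ : Type u} [Field k] [Ring A] [Algebra k⟦X⟧ A] [Ring A₀] [Algebra k A₀]
variable {π : A →+* A₀} (hπ : IsDeformation (k := k) π)
variable {N N' : Type u} [AddCommGroup N] [Module A N] [AddCommGroup N'] [Module A N']

/-- The reduction modulo `h` of a linear form. -/
noncomputable def reduceHom : (N →ₗ[A] A) →+ (Reduction hπ N →ₗ[A₀] A₀) where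
  toFun φ := Reduction.lift (π.toAddMonoidHom.comp φ.toAddMonoidHom) fun a n => by
    change π (φ (a • n)) = π a * π (φ n)
    rw [map_smul, smul_eq_mul, map_mul]
  map_zero' := Reduction.hom_ext fun n => map_zero π
  map_add' φ ψ := Reduction.hom_ext fun n => map_add π _ _

@[simp]
theorem reduceHom_mk (φ : N →ₗ[A] A) (n : N) : reduceHom hπ φ (Reduction.mk hπ n) = π (φ n) := rfl

theorem reduceHom_comp (φ : N' →ₗ[A] A) (f : N →ₗ[A] N') :
    reduceHom hπ (φ.comp f) = (reduceHom hπ φ).comp (Reduction.map hπ f) :=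
  Reduction.hom_ext fun _ => rfl

theorem reduceHom_smul_apply (c : k⟦X⟧) (φ : N →ₗ[A] A) (x : Reduction hπ N) :
    reduceHom hπ (c • φ) x = algebraMap k A₀ (constantCoeff c) * reduceHom hπ φ x := by
  obtain ⟨n, rfl⟩ := Reduction.mk_surjective x
  rw [reduceHom_mk, LinearMap.smul_apply, Algebra.smul_def, map_mul, hπ.map_algebraMap,
    reduceHom_mk]

theorem reduceHom_X_smul (φ : N →ₗ[A] A) : reduceHom hπ ((X : k⟦X⟧) • φ) = 0 :=
  LinearMap.ext fun x => by
    rw [reduceHom_smul_apply, constantCoeff_X, map_zero, zero_mul, LinearMap.zero_apply]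

/-- The values can be divided by h one by one, and the quotient is linear because A has no
h-torsion. -/
theorem exists_eq_X_smul_of_reduceHom_eq_zero {φ : N →ₗ[A] A} (h : reduceHom hπ φ = 0) :
    ∃ φ' : N →ₗ[A] A, φ = (X : k⟦X⟧) • φ' := by
  choose φ' hφ' using fun n : N => (hπ.ker_eq (φ n)).1
    (LinearMap.congr_fun h (Reduction.mk hπ n))
  refine ⟨{ toFun := φ', map_add' := fun x y => ?_, map_smul' := fun a x => ?_ },
    LinearMap.ext hφ'⟩
  · refine hπ.isHComplete.smul_cancel ?_
    rw [← hφ', map_add, smul_add, ← hφ', ← hφ']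
  · refine hπ.isHComplete.smul_cancel ?_
    rw [← hφ', map_smul, RingHom.id_apply, smul_comm, ← hφ']

/-- Projectivity of N lifts a form with values in A₀ through the surjection π. -/
theorem reduceHom_surjective [Module.Projective A N] : Function.Surjective (reduceHom hπ (N := N)) := by
  intro ψ
  let _ : Module A A₀ := Module.compHom A₀ π
  let p : A →ₗ[A] A₀ :=
    { toFun := π, map_add' := map_add π, map_smul' := fun a b => map_mul π a b }
  let q : N →ₗ[A] A₀ :=
    { toFun := fun n => ψ (Reduction.mk hπ n)
      map_add' := fun x y => by rw [map_add, map_add]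
      map_smul' := fun a x => by
        rw [← Reduction.map_smul_mk, map_smul]
        rfl }
  obtain ⟨φ, hφ⟩ := Module.projective_lifting_property p q hπ.surjective
  exact ⟨φ, Reduction.hom_ext fun n => LinearMap.congr_fun hφ n⟩

end ReduceHom

/-! ### Lifting cohomology from the reduction -/

section Comparison

variable {k A A₀ : Type u} [Field k] [Ring A] [Algebra k⟦X⟧ A] [Ring A₀] [Algebra k A₀]
variable {π : A →+* A₀} (hπ : IsDeformation (k := k) π)
variable (L : ChainComplex (ModuleCat.{u} A) ℕ)

/-- The differential of the complex of linear forms. -/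
noncomputable def coboundary (i j : ℕ) : (L.X i →ₗ[A] A) →ₗ[k⟦X⟧] (L.X j →ₗ[A] A) where
  toFun φ := φ.comp (L.d j i).hom
  map_add' _ _ := rfl
  map_smul' _ _ := rfl

theorem coboundary_coboundary (i j l : ℕ) (φ : L.X i →ₗ[A] A) :
    coboundary (k := k) L j l (coboundary (k := k) L i j φ) = 0 := by
  refine LinearMap.ext fun x => ?_
  change φ ((L.d l j ≫ L.d j i).hom x) = 0
  rw [L.d_comp_d]
  exact map_zero φ

/-- The differential of the complex of linear forms on the reduction modulo `h`. -/
noncomputable def coboundary₀ (i j : ℕ) :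
    (Reduction hπ (L.X i) →ₗ[A₀] A₀) →+ (Reduction hπ (L.X j) →ₗ[A₀] A₀) where
  toFun φ := φ.comp (Reduction.map hπ (L.d j i).hom)
  map_zero' := rfl
  map_add' _ _ := rfl

theorem reduceHom_coboundary (i j : ℕ) (φ : L.X i →ₗ[A] A) :
    reduceHom hπ (coboundary (k := k) L i j φ) = coboundary₀ hπ L i j (reduceHom hπ φ) :=
  reduceHom_comp hπ φ _

variable {L} {d a : ℕ} [∀ i, Module.Projective A (L.X i)]

/-- Exactness modulo `h` implies exactness. -/
theorem exact_of_exact_reduction {i : ℕ}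
    (h : ∀ ψ, coboundary₀ hπ L i (i + 1) ψ = 0 → ∃ χ, coboundary₀ hπ L a i χ = ψ)
    (φ : L.X i →ₗ[A] A) (hφ : coboundary (k := k) L i (i + 1) φ = 0) :
    ∃ χ, coboundary (k := k) L a i χ = φ := by
  have hA := hπ.isHComplete
  refine IsHComplete.mem_range_of_approx (hA.linearMap _) (hA.linearMap _)
    (coboundary (k := k) L a i) {φ | coboundary (k := k) L i (i + 1) φ = 0} ?_ φ hφ
  intro z hz
  obtain ⟨χ₀, hχ₀⟩ := h (reduceHom hπ z) (by
    rw [← reduceHom_coboundary, show coboundary (k := k) L i (i + 1) z = 0 from hz, map_zero])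
  obtain ⟨χ, rfl⟩ := reduceHom_surjective hπ χ₀
  obtain ⟨z', hz'⟩ := exists_eq_X_smul_of_reduceHom_eq_zero hπ
    (φ := z - coboundary (k := k) L a i χ) (by
      rw [map_sub, reduceHom_coboundary, hχ₀, sub_self])
  -- The cocycle z - δχ equals h z', so z' is a cocycle for lack of h-torsion, and the approximation
  -- can be iterated.
  refine ⟨χ, z', (hA.linearMap _).torsionFree _ ?_, ?_⟩
  · rw [← map_smul, ← hz', map_sub, coboundary_coboundary, show coboundary L i (i + 1) z = 0 from hz,
      sub_self]
  · rw [← hz']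
    abel

/-- If the cohomology modulo `h` in degree `d` has dimension one, and vanishes in the neighbouring
degrees, then the cohomology in degree `d` is free of rank one. -/
theorem exists_generator_of_reduction
    (hnext : ∀ ψ, coboundary₀ hπ L (d + 1) (d + 2) ψ = 0 → ∃ χ, coboundary₀ hπ L d (d + 1) χ = ψ)
    (hprev : ∀ ψ, coboundary₀ hπ L a d ψ = 0 →
      ∃ χ : L.X a →ₗ[A] A, coboundary (k := k) L a d χ = 0 ∧ reduceHom hπ χ = ψ)
    (z₀ : Reduction hπ (L.X d) →ₗ[A₀] A₀) (hz₀ : coboundary₀ hπ L d (d + 1) z₀ = 0)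
    (hgen : ∀ ψ, coboundary₀ hπ L d (d + 1) ψ = 0 → ∃ (c : k) (χ : _),
      ∀ x, ψ x = algebraMap k A₀ c * z₀ x + coboundary₀ hπ L a d χ x)
    (hfree : ∀ (c : k) (χ : _), (∀ x, algebraMap k A₀ c * z₀ x = coboundary₀ hπ L a d χ x) →
      c = 0) :
    ∃ z : L.X d →ₗ[A] A, coboundary (k := k) L d (d + 1) z = 0 ∧
      (∀ φ, coboundary (k := k) L d (d + 1) φ = 0 → ∃ (c : k⟦X⟧) (χ : _),
        φ = c • z + coboundary (k := k) L a d χ) ∧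
      ∀ (c : k⟦X⟧) (χ : _), c • z = coboundary (k := k) L a d χ → c = 0 := by
  have hA := hπ.isHComplete
  -- A lift y of z₀ is a cocycle only modulo h: δy = h w. Then w is a cocycle, exactness in degree d
  -- + 1 gives w = δv, and y - h v is a genuine cocycle lifting z₀.
  obtain ⟨y, hy⟩ := reduceHom_surjective hπ z₀
  obtain ⟨w, hw⟩ := exists_eq_X_smul_of_reduceHom_eq_zero hπ
    (φ := coboundary (k := k) L d (d + 1) y) (by rw [reduceHom_coboundary, hy, hz₀])
  obtain ⟨v, hv⟩ := exact_of_exact_reduction hπ hnext w ((hA.linearMap _).torsionFree _ (by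
    rw [← map_smul, ← hw, coboundary_coboundary]))
  let z := y - (X : k⟦X⟧) • v
  have hz : coboundary (k := k) L d (d + 1) z = 0 := by
    rw [map_sub, map_smul, hv, ← hw, sub_self]
  have hzz₀ : reduceHom hπ z = z₀ := by
    rw [map_sub, reduceHom_X_smul, sub_zero, hy]
  refine ⟨z, hz, fun φ hφ => ?_, fun c χ hc => ?_⟩
  -- The scalar c and the cochain χ are approximated together, as an argument of the map (c, χ) ↦ c
  -- z + δχ.
  · obtain ⟨⟨c, χ⟩, h⟩ := IsHComplete.mem_range_of_approx
      (isHComplete_self.prod (hA.linearMap _)) (hA.linearMap _)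
      ((LinearMap.toSpanSingleton k⟦X⟧ _ z).coprod (coboundary (k := k) L a d))
      {φ | coboundary (k := k) L d (d + 1) φ = 0} (fun φ hφ => by
        obtain ⟨c, χ₀, h⟩ := hgen (reduceHom hπ φ) (by
          rw [← reduceHom_coboundary, show coboundary (k := k) L d (d + 1) φ = 0 from hφ, map_zero])
        obtain ⟨χ, rfl⟩ := reduceHom_surjective hπ χ₀
        obtain ⟨φ', hφ'⟩ := exists_eq_X_smul_of_reduceHom_eq_zero hπ
          (φ := φ - ((PowerSeries.C c : k⟦X⟧) • z + coboundary (k := k) L a d χ)) (by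
            refine LinearMap.ext fun x => ?_
            rw [map_sub, map_add, LinearMap.sub_apply, LinearMap.add_apply, reduceHom_smul_apply,
              constantCoeff_C, reduceHom_coboundary, hzz₀, h, sub_self, LinearMap.zero_apply])
        refine ⟨(PowerSeries.C c, χ), φ', (hA.linearMap _).torsionFree _ ?_, ?_⟩
        · rw [← map_smul, ← hφ', map_sub, map_add, map_smul, hz, coboundary_coboundary,
            show coboundary L d (d + 1) φ = 0 from hφ]
          simp
        · rw [← hφ']
          simp) φ hφ
    exact ⟨c, χ, h.symm⟩
  -- Infinite descent: if c z is a coboundary, then c = h c' and c' z is again a coboundary, so c is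
  -- divisible by every power of h.
  · have key : ∀ c : k⟦X⟧, (∃ χ, c • z = coboundary (k := k) L a d χ) →
        ∃ c', c = X * c' ∧ ∃ χ, c' • z = coboundary (k := k) L a d χ := by
      rintro c ⟨χ, hc⟩
      have h0 : constantCoeff c = 0 := hfree _ (reduceHom hπ χ) fun x => by
        rw [← reduceHom_coboundary, ← hc, reduceHom_smul_apply, hzz₀]
      obtain ⟨c', rfl⟩ := PowerSeries.X_dvd_iff.2 h0
      refine ⟨c', rfl, ?_⟩
      -- χ reduces to a cocycle, which lifts to a cocycle ξ. Subtracting ξ does not change δχ and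
      -- makes χ divisible by h.
      obtain ⟨ξ, hξ, hξ'⟩ := hprev (reduceHom hπ χ) (by
        rw [← reduceHom_coboundary, ← hc, mul_smul, reduceHom_X_smul])
      obtain ⟨χ', hχ'⟩ := exists_eq_X_smul_of_reduceHom_eq_zero hπ (φ := χ - ξ) (by
        rw [map_sub, hξ', sub_self])
      refine ⟨χ', (hA.linearMap _).smul_cancel ?_⟩
      rw [← map_smul, ← hχ', map_sub, hξ, sub_zero, ← hc, mul_smul]
    choose! q hq hq' using key
    have hall : ∀ n, ∃ χ, q^[n] c • z = coboundary (k := k) L a d χ := fun n => by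
      induction n with
      | zero => exact ⟨χ, hc⟩
      | succ n ih =>
        rw [Function.iterate_succ_apply']
        exact hq' _ ih
    exact isHComplete_self.separated (fun n => q^[n] c) (fun n => by
      rw [Function.iterate_succ_apply']
      exact hq _ (hall n)) 0

end Comparison

/-! ### The dualizing module -/

section RankOne

variable {K R : Type u} [CommRing K] [Ring R] [Algebra K R]

theorem op_smul_linearMap_apply {N : Type*} [AddCommGroup N] [Module R N] (c : K) (φ : N →ₗ[R] R)
    (x : N) : (op (algebraMap K R c) • φ) x = algebraMap K R c * φ x :=
  (Algebra.commutes c (φ x)).symm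

variable (K) in
/-- `Ext^i_R(M, R)` is free of rank one over `K` if and only if there is a cocycle whose class
generates it freely. -/
theorem nonempty_extToRing_equiv_iff {M : ModuleCat.{u} R} (P : ProjectiveResolution M) (i : ℕ) :
    Nonempty (asBase K (extToRing R i M) ≃ₗ[K] K) ↔ ∃ z : P.complex.X i →ₗ[R] R,
      z.comp (P.complex.d (i + 1) i).hom = 0 ∧
      (∀ φ : P.complex.X i →ₗ[R] R, φ.comp (P.complex.d (i + 1) i).hom = 0 →
        ∃ (c : K) (χ : P.complex.X ((ComplexShape.up ℕ).prev i) →ₗ[R] R), ∀ x,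
          φ x = algebraMap K R c * z x + χ (P.complex.d i ((ComplexShape.up ℕ).prev i) x)) ∧
      ∀ (c : K) (χ : P.complex.X ((ComplexShape.up ℕ).prev i) →ₗ[R] R),
        (∀ x, algebraMap K R c * z x = χ (P.complex.d i ((ComplexShape.up ℕ).prev i) x)) →
          c = 0 := by
  let C := homComplex P.complex
  let e : C.homology i ≃ₗ[Rᵐᵒᵖ] extToRing R i M := (extToRingIso P i).symm.toLinearEquiv
  let cls : LinearMap.ker (C.d i ((ComplexShape.up ℕ).next i)).hom →ₗ[Rᵐᵒᵖ] extToRing R i M :=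
    e.toLinearMap.comp (homologyClass C i)
  have hsurj : Function.Surjective cls := e.surjective.comp (homologyClass_surjective C i)
  have hzero : ∀ φ, cls φ = 0 ↔ ∃ χ : P.complex.X ((ComplexShape.up ℕ).prev i) →ₗ[R] R,
      χ.comp (P.complex.d i ((ComplexShape.up ℕ).prev i)).hom = φ.1 := fun φ => by
    have : cls φ = 0 ↔ homologyClass C i φ = 0 := e.map_eq_zero_iff
    rw [this]
    exact homologyClass_eq_zero_iff C i φ
  have hmem : ∀ φ : P.complex.X i →ₗ[R] R, φ.comp (P.complex.d (i + 1) i).hom = 0 ↔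
      φ ∈ LinearMap.ker (C.d i ((ComplexShape.up ℕ).next i)).hom := fun φ => by
    have h2 : (ComplexShape.up ℕ).next i = i + 1 := by simp
    rw [h2]
    rfl
  constructor
  · rintro ⟨f⟩
    obtain ⟨⟨(z : P.complex.X i →ₗ[R] R), hz⟩, hcz⟩ := hsurj (f.symm 1)
    have hf : ∀ c : K, f (op (algebraMap K R c) • cls ⟨z, hz⟩ : extToRing R i M) = c := fun c => by
      rw [hcz]
      refine (f.map_smul c (f.symm 1)).trans ?_
      rw [f.apply_symm_apply, smul_eq_mul, mul_one]
    refine ⟨z, (hmem z).2 hz, fun φ hφ => ?_, fun c χ h => ?_⟩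
    · let φ' : LinearMap.ker (C.d i ((ComplexShape.up ℕ).next i)).hom := ⟨φ, (hmem φ).1 hφ⟩
      obtain ⟨χ, hχ⟩ := (hzero (φ' - op (algebraMap K R (f (cls φ'))) • ⟨z, hz⟩)).1 (by
        rw [map_sub, map_smul, sub_eq_zero]
        exact f.injective (hf _).symm)
      refine ⟨f (cls φ'), χ, fun x => ?_⟩
      have h1 := LinearMap.congr_fun hχ x
      change χ (P.complex.d i ((ComplexShape.up ℕ).prev i) x) =
        φ x - (op (algebraMap K R (f (cls φ'))) • z) x at h1
      rw [h1, op_smul_linearMap_apply]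
      abel
    · have h1 := (hzero (op (algebraMap K R c) • ⟨z, hz⟩)).2 ⟨χ, LinearMap.ext fun x =>
        (h x).symm.trans (op_smul_linearMap_apply c z x).symm⟩
      rw [map_smul] at h1
      rw [← hf c, h1]
      exact map_zero f
  · rintro ⟨z, hz, hgen, hfree⟩
    let z' : LinearMap.ker (C.d i ((ComplexShape.up ℕ).next i)).hom := ⟨z, (hmem z).1 hz⟩
    let ω : asBase K (extToRing R i M) := cls z'
    refine ⟨(LinearEquiv.ofBijective (LinearMap.toSpanSingleton K _ ω) ⟨?_, ?_⟩).symm⟩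
    · rw [← LinearMap.ker_eq_bot, LinearMap.ker_eq_bot']
      intro c hc
      have hc' : cls (op (algebraMap K R c) • z') = 0 := (map_smul cls _ _).trans hc
      obtain ⟨χ, hχ⟩ := (hzero _).1 hc'
      exact hfree c χ fun x =>
        (op_smul_linearMap_apply c z x).symm.trans (LinearMap.congr_fun hχ x).symm
    · intro m
      obtain ⟨φ, rfl⟩ := hsurj m
      obtain ⟨c, χ, h⟩ := hgen φ.1 ((hmem _).2 φ.2)
      refine ⟨c, ?_⟩
      have h1 : cls (φ - op (algebraMap K R c) • z') = 0 := (hzero _).2 ⟨χ, LinearMap.ext fun x => by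
        change χ (P.complex.d i ((ComplexShape.up ℕ).prev i) x) =
          (show P.complex.X i →ₗ[R] R from φ.1) x -
            (op (algebraMap K R c) • z : P.complex.X i →ₗ[R] R) x
        rw [op_smul_linearMap_apply, h]
        abel⟩
      rw [map_sub, map_smul, sub_eq_zero] at h1
      exact h1.symm

/-- A right module that is free of rank one over `K` is given by a character. -/
theorem exists_character {M : ModuleCat.{u} Rᵐᵒᵖ} (e : asBase K M ≃ₗ[K] K) :
    ∃ θ : R →ₐ[K] K, ∀ (u : R) (m : M), op u • m = algebraMap K Rᵐᵒᵖ (θ u) • m := by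
  let ω : M := e.symm 1
  let f : M → K := fun m => e m
  have f_add : ∀ m m', f (m + m') = f m + f m' := fun m m' => map_add e m m'
  have f_smul : ∀ (c : K) (m : M), f (algebraMap K Rᵐᵒᵖ c • m) = c * f m := fun c m => e.map_smul c m
  have f_ω : f ω = 1 := e.apply_symm_apply 1
  have f_inj : Function.Injective f := e.injective
  have comm : ∀ (u : R) (c : K) (m : M),
      op u • algebraMap K Rᵐᵒᵖ c • m = algebraMap K Rᵐᵒᵖ c • op u • m := fun u c m => by
    rw [smul_smul, smul_smul, Algebra.commutes]
  have hspan : ∀ m : M, m = algebraMap K Rᵐᵒᵖ (f m) • ω := fun m => f_inj (by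
    rw [f_smul, f_ω, mul_one])
  have hact : ∀ (u : R) (m : M), op u • m = algebraMap K Rᵐᵒᵖ (f (op u • ω)) • m := fun u m => by
    refine f_inj ?_
    rw [hspan m, comm]
    simp only [f_smul, f_ω, mul_one]
    exact mul_comm _ _
  refine ⟨AlgHom.ofLinearMap
    { toFun := fun u => f (op u • ω)
      map_add' := fun u v => by rw [MulOpposite.op_add, add_smul, f_add]
      map_smul' := fun c u => ?_ } ?_ ?_, hact⟩
  · rw [Algebra.smul_def, MulOpposite.op_mul, mul_smul, ← MulOpposite.algebraMap_apply, comm, f_smul]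
    rfl
  · change f (op 1 • ω) = 1
    rw [MulOpposite.op_one, one_smul, f_ω]
  · intro u v
    change f (op (u * v) • ω) = f (op u • ω) * f (op v • ω)
    rw [MulOpposite.op_mul, mul_smul, hact u ω, comm, f_smul, f_smul, f_ω, mul_one]

end RankOne

section DualizingModule

variable {k A A₀ : Type u} [Field k] [Ring A] [Algebra k⟦X⟧ A] [Ring A₀] [Algebra k A₀]
variable {π : A →+* A₀}

theorem subsingleton_extToRing_of_reduction (H : TopHopfAlgebra k A)
    (hπ : IsDeformation (k := k) π) (ε₀ : A₀ →ₐ[k] k)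
    (hε₀ : ∀ a : A, ε₀ (π a) = PowerSeries.constantCoeff (H.ε a)) (i : ℕ)
    (h : Subsingleton (extToRing A₀ i (augModule ε₀.toRingHom))) :
    Subsingleton (extToRing A i (augModule H.ε.toRingHom)) := by
  let P := projectiveResolution (augModule H.ε.toRingHom)
  have : ∀ i, Module.Projective A (P.complex.X i) := fun i =>
    (IsProjective.iff_projective (R := A) _).2 (P.projective i)
  rw [subsingleton_extToRing_iff (reductionResolution H hπ ε₀ hε₀ P)] at h
  rw [subsingleton_extToRing_iff P]
  exact exact_of_exact_reduction hπ h

theorem nonempty_extToRing_equiv_of_reduction (H : TopHopfAlgebra k A)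
    (hπ : IsDeformation (k := k) π) (ε₀ : A₀ →ₐ[k] k)
    (hε₀ : ∀ a : A, ε₀ (π a) = PowerSeries.constantCoeff (H.ε a)) (d : ℕ)
    (hvanish : ∀ i : ℕ, i ≠ d → Subsingleton (extToRing A₀ i (augModule ε₀.toRingHom)))
    (hone : Nonempty (asBase k (extToRing A₀ d (augModule ε₀.toRingHom)) ≃ₗ[k] k)) :
    Nonempty (asBase k⟦X⟧ (extToRing A d (augModule H.ε.toRingHom)) ≃ₗ[k⟦X⟧] k⟦X⟧) := by
  let P := projectiveResolution (augModule H.ε.toRingHom)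
  let P₀ := reductionResolution H hπ ε₀ hε₀ P
  have : ∀ i, Module.Projective A (P.complex.X i) := fun i =>
    (IsProjective.iff_projective (R := A) _).2 (P.projective i)
  have hex := fun i hi => (subsingleton_extToRing_iff P₀ i).1 (hvanish i hi)
  obtain ⟨z₀, hz₀, hgen, hfree⟩ := (nonempty_extToRing_equiv_iff k P₀ d).1 hone
  have hnext := hex (d + 1) (by omega)
  rw [CochainComplex.prev_nat_succ] at hnext
  have hprev : ∀ a, (ComplexShape.up ℕ).prev d = a →
      ∀ ψ : Reduction hπ (P.complex.X a) →ₗ[A₀] A₀, coboundary₀ hπ P.complex a d ψ = 0 →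
        ∃ χ : P.complex.X a →ₗ[A] A, coboundary (k := k) P.complex a d χ = 0 ∧
          reduceHom hπ χ = ψ := by
    intro a ha ψ hψ
    cases d with
    | zero =>
      -- No differential enters degree 0, so every lift has zero coboundary.
      obtain ⟨χ, rfl⟩ := reduceHom_surjective hπ ψ
      refine ⟨χ, LinearMap.ext fun x => ?_, rfl⟩
      change χ ((P.complex.d 0 a).hom x) = 0
      rw [P.complex.shape _ _ (by simp)]
      exact map_zero χ
    | succ d =>
      rw [CochainComplex.prev_nat_succ] at ha
      subst ha
      -- Ext vanishes just below the critical degree, so ψ is a coboundary; the coboundary of a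
      -- lifted primitive is a cocycle lifting ψ.
      obtain ⟨ξ₀, rfl⟩ := hex d (by omega) ψ hψ
      obtain ⟨ξ, rfl⟩ := reduceHom_surjective hπ (N := P.complex.X _) ξ₀
      exact ⟨coboundary (k := k) P.complex _ _ ξ, coboundary_coboundary _ _ _ _ _,
        reduceHom_coboundary hπ P.complex _ _ ξ⟩
  obtain ⟨z, hz, hzgen, hzfree⟩ := exists_generator_of_reduction hπ (L := P.complex)
    hnext (hprev _ rfl)
    z₀ hz₀ hgen hfree
  refine (nonempty_extToRing_equiv_iff k⟦X⟧ P d).2 ⟨z, hz, fun φ hφ => ?_, fun c χ hc => ?_⟩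
  · obtain ⟨c, χ, rfl⟩ := hzgen φ hφ
    refine ⟨c, χ, fun x => ?_⟩
    rw [← Algebra.smul_def]
    rfl
  · refine hzfree c χ (LinearMap.ext fun x => ?_)
    rw [LinearMap.smul_apply, Algebra.smul_def]
    exact hc x

end DualizingModule

/-! ### Automatic continuity -/

namespace TopHopfAlgebra

variable {k A : Type u} [Field k] [Ring A] [Algebra k⟦X⟧ A] (H : TopHopfAlgebra k A)

theorem pow_mem_J_pow {x : A} (hx : x ∈ H.J) (n : ℕ) : x ^ n ∈ H.J ^ n := by
  induction n with
  | zero => exact Ideal.mem_pow_zero _ _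
  | succ n ih =>
    rw [pow_succ]
    refine Ideal.mul_mem_pow_add H.J ih ?_
    rwa [Submodule.pow_one]

/-- The inverse of `1 - x` is the geometric series. -/
theorem exists_mul_one_sub_eq_one {x : A} (hx : x ∈ H.J) : ∃ a : A, a * (1 - x) = 1 := by
  obtain ⟨a, ha⟩ := H.adicComplete.complete (fun n => ∑ i ∈ Finset.range n, x ^ i) fun n => by
    rw [Finset.sum_range_succ, add_sub_cancel_left]
    exact H.pow_mem_J_pow hx n
  refine ⟨a, H.eq_of_forall_sub_mem fun n => ?_⟩
  have h1 := Ideal.mul_mem_right (1 - x) _ (ha n)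
  have h2 := geom_sum_mul_neg x n
  have h3 := neg_mem (add_mem h1 (H.pow_mem_J_pow hx n))
  rw [sub_mul, h2] at h3
  convert h3 using 1
  abel

/-- For x in J every 1 + yx has a left inverse, a geometric series. This allows Nakayama's lemma to
be used with J. -/
theorem J_le_jacobson : H.J ≤ Ring.jacobson A := by
  intro x hx
  rw [← Ideal.jacobson_bot, Ideal.mem_jacobson_iff]
  intro y
  obtain ⟨z, hz⟩ := H.exists_mul_one_sub_eq_one (neg_mem (Ideal.mul_mem_left _ y hx))
  refine ⟨z, ?_⟩
  rw [Ideal.mem_bot, ← hz]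
  noncomm_ring

/-- Characters of `A` are automatically continuous. -/
theorem isContinuousForm_algHom (χ : A →ₐ[k⟦X⟧] k⟦X⟧) : H.IsContinuousForm χ.toLinearMap := by
  have h1 : ∀ a ∈ H.J, (X : k⟦X⟧) ∣ χ a := by
    intro a ha
    rw [X_dvd_iff]
    -- Otherwise χ(a) has an inverse u, and 1 - u a, which is left invertible, is sent to 0.
    by_contra hne
    have hunit : IsUnit (χ a) := isUnit_iff_constantCoeff.2 (isUnit_iff_ne_zero.2 hne)
    obtain ⟨u, hu⟩ := hunit.exists_left_inv
    obtain ⟨b, hb⟩ := H.exists_mul_one_sub_eq_one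
      (show u • a ∈ H.J by rw [Algebra.smul_def]; exact Ideal.mul_mem_left _ _ ha)
    have := congrArg χ hb
    rw [map_mul, map_sub, map_smul, map_one, smul_eq_mul, hu, sub_self, mul_zero] at this
    exact zero_ne_one this
  intro m
  refine ⟨m, fun a ha => ?_⟩
  have := pow_mem_of_map_mem χ.toRingHom H.J (Ideal.span {X})
    (fun x hx => Ideal.mem_span_singleton.2 (h1 x hx)) m a ha
  rwa [Ideal.span_singleton_pow, Ideal.mem_span_singleton] at this

variable (V : Type*) [AddCommGroup V] [Module k⟦X⟧ V] [Module A V] [IsScalarTower k⟦X⟧ A V]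
  [Module.Finite k⟦X⟧ V]

variable (k A) in
theorem hElem_smul_eq {V : Type*} [AddCommGroup V] [Module k⟦X⟧ V] [Module A V]
    [IsScalarTower k⟦X⟧ A V] (v : V) : hElem k A • v = (X : k⟦X⟧) • v :=
  algebraMap_smul A _ v

/-- V/hV is finite-dimensional over the residue field, and its A-submodules are subspaces. -/
instance isArtinian_quotient_hSubmodule : IsArtinian A (V ⧸ hSubmodule k A V) := by
  let I := IsLocalRing.maximalIdeal k⟦X⟧
  let : Field (k⟦X⟧ ⧸ I) := Ideal.Quotient.field I
  have : Module.Finite (k⟦X⟧ ⧸ I) (V ⧸ I • (⊤ : Submodule k⟦X⟧ V)) :=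
    Module.Finite.of_restrictScalars_finite k⟦X⟧ _ _
  have h1 : IsArtinian (k⟦X⟧ ⧸ I) (V ⧸ I • (⊤ : Submodule k⟦X⟧ V)) := inferInstance
  have h2 : IsArtinian k⟦X⟧ (V ⧸ I • (⊤ : Submodule k⟦X⟧ V)) :=
    isArtinian_of_surjective_algebraMap (R := k⟦X⟧ ⧸ I) Ideal.Quotient.mk_surjective
  have hle : I • (⊤ : Submodule k⟦X⟧ V) ≤
      LinearMap.ker ((hSubmodule k A V).mkQ.restrictScalars k⟦X⟧) := by
    rw [Submodule.smul_le]
    intro c hc v _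
    rw [show I = Ideal.span {X} from maximalIdeal_eq_span_X, Ideal.mem_span_singleton] at hc
    obtain ⟨c, rfl⟩ := hc
    rw [LinearMap.mem_ker]
    refine (Submodule.Quotient.mk_eq_zero _).2 ⟨c • v, ?_⟩
    rw [hElem_smul_eq, smul_smul]
  have h3 : IsArtinian k⟦X⟧ (V ⧸ hSubmodule k A V) :=
    isArtinian_of_surjective _ (Submodule.liftQ _ _ hle) fun x => by
      obtain ⟨v, rfl⟩ := Submodule.mkQ_surjective _ x
      exact ⟨Submodule.Quotient.mk v, rfl⟩
  exact isArtinian_of_tower k⟦X⟧ h3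

/-- A sufficiently high power of `J` acts by multiples of `h` on a module of finite type. -/
theorem exists_smul_eq_X_smul :
    ∃ n : ℕ, ∀ a ∈ H.J ^ n, ∀ v : V, ∃ w : V, a • v = (X : k⟦X⟧) • w := by
  let Q := V ⧸ hSubmodule k A V
  have hQ : IsNoetherian A Q := isNoetherian_of_tower k⟦X⟧ inferInstance
  have hanti : ∀ m n, m ≤ n → H.J ^ n • (⊤ : Submodule A Q) ≤ H.J ^ m • (⊤ : Submodule A Q) :=
    fun m n h => Submodule.smul_mono_left (Ideal.pow_le_pow_right h)
  obtain ⟨n, hn⟩ := IsArtinian.monotone_stabilizes (R := A) (M := Q)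
    ⟨fun n => OrderDual.toDual (H.J ^ n • (⊤ : Submodule A Q)), fun m n h => hanti m n h⟩
  -- The descending chain J^n Q stabilizes, so M = J^(n+1) Q satisfies M = J M and is zero by
  -- Nakayama.
  have h1 : H.J ^ (n + 1) • (⊤ : Submodule A Q) = H.J ^ (n + 1 + 1) • (⊤ : Submodule A Q) :=
    (hn (n + 1) (by omega)).symm.trans (hn (n + 1 + 1) (by omega))
  have h2 : H.J ^ (n + 1) • (⊤ : Submodule A Q) = ⊥ := by
    refine Submodule.FG.eq_bot_of_le_jacobson_smul (IsNoetherian.noetherian _) ?_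
    conv_lhs => rw [h1, Submodule.pow_succ' (h := n.succ_ne_zero)]
    rw [Submodule.mul_smul]
    exact Submodule.smul_mono_left H.J_le_jacobson
  refine ⟨n + 1, fun a ha v => ?_⟩
  have h3 : a • (hSubmodule k A V).mkQ v ∈ H.J ^ (n + 1) • (⊤ : Submodule A Q) :=
    Submodule.smul_mem_smul ha trivial
  rw [h2, Submodule.mem_bot, ← map_smul, Submodule.mkQ_apply, Submodule.Quotient.mk_eq_zero] at h3
  obtain ⟨w, hw⟩ := h3
  exact ⟨w, by rw [← hw, hElem_smul_eq]⟩

theorem exists_smul_eq_X_pow_smul (m : ℕ) :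
    ∃ n : ℕ, ∀ a ∈ H.J ^ n, ∀ v : V, ∃ w : V, a • v = (X ^ m : k⟦X⟧) • w := by
  induction m with
  | zero => exact ⟨0, fun a _ v => ⟨a • v, by rw [pow_zero, one_smul]⟩⟩
  | succ m ih =>
    obtain ⟨n, hn⟩ := ih
    obtain ⟨n', hn'⟩ := H.exists_smul_eq_X_smul V
    -- The extra 1 only ensures the nonzero exponent required by `Submodule.pow_add`.
    refine ⟨n + (n' + 1), fun a ha => ?_⟩
    rw [Submodule.pow_add _ n'.succ_ne_zero] at ha
    induction ha using Submodule.smul_induction_on' with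
    | smul r hr s hs =>
      intro v
      obtain ⟨w, hw⟩ := hn' s (H.J_pow_le n'.le_succ hs) v
      obtain ⟨w', hw'⟩ := hn r hr w
      refine ⟨w', ?_⟩
      rw [smul_eq_mul, mul_smul, hw, smul_algebra_smul_comm, hw', smul_smul, pow_succ']
    | add x _ y _ hx hy =>
      intro v
      obtain ⟨w, hw⟩ := hx v
      obtain ⟨w', hw'⟩ := hy v
      exact ⟨w + w', by rw [add_smul, hw, hw', smul_add]⟩

end TopHopfAlgebra

/-! ### Matrix coefficients of a module free of finite rank -/

section MatrixRep

variable {K A V : Type*} [CommRing K] [Ring A] [Algebra K A] [AddCommGroup V] [Module K V]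
  [Module A V] [IsScalarTower K A V] {ι : Type*} [Fintype ι] [DecidableEq ι]

variable (A) in
/-- The matrix representation on a free module of finite rank. -/
noncomputable def matrixRep (b : Module.Basis ι K V) : A →ₐ[K] Matrix ι ι K :=
  (LinearMap.toMatrixAlgEquiv b).toAlgHom.comp (Algebra.lsmul K K V)

theorem matrixRep_apply (b : Module.Basis ι K V) (a : A) (i j : ι) :
    matrixRep A b a i j = b.repr (a • b j) i :=
  LinearMap.toMatrixAlgEquiv_apply b _ i j

theorem sum_matrixRep_smul (b : Module.Basis ι K V) (a : A) (j : ι) :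
    ∑ i, matrixRep A b a i j • b i = a • b j := by
  simp only [matrixRep_apply]
  exact b.sum_repr _

end MatrixRep

theorem TopHopfAlgebra.isContinuousRep_matrixRep {k A : Type u} [Field k] [Ring A]
    [Algebra k⟦X⟧ A] (H : TopHopfAlgebra k A) {V : Type*} [AddCommGroup V] [Module k⟦X⟧ V]
    [Module A V] [IsScalarTower k⟦X⟧ A V] {ι : Type} [Fintype ι] [DecidableEq ι]
    (b : Module.Basis ι k⟦X⟧ V) : H.IsContinuousRep (matrixRep A b) := by
  intro i j m
  have : Module.Finite k⟦X⟧ V := Module.Finite.of_basis b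
  obtain ⟨n, hn⟩ := H.exists_smul_eq_X_pow_smul V m
  refine ⟨n, fun a ha => ?_⟩
  obtain ⟨w, hw⟩ := hn a ha (b j)
  rw [coeffForm_apply]
  change _ ∣ matrixRep A b a i j
  rw [matrixRep_apply, hw, map_smul]
  exact ⟨_, rfl⟩

/-! ### The twisted right action on `Ω ⊗ V*` -/

section HTendsto

variable {k W : Type*} [Field k] [AddCommGroup W] [Module k⟦X⟧ W] [Module.Free k⟦X⟧ W]

theorem HTendsto.unique {x : ℕ → W} {y z : W} (hy : HTendsto (k := k) x y)
    (hz : HTendsto (k := k) x z) : y = z := by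
  let b := Module.Free.chooseBasis k⟦X⟧ W
  refine sub_eq_zero.1 (b.repr.map_eq_zero_iff.1 (Finsupp.ext fun i =>
    PowerSeries.eq_zero_of_forall_X_pow_dvd fun m => ?_))
  obtain ⟨N, hN⟩ := hy m
  obtain ⟨N', hN'⟩ := hz m
  obtain ⟨w, hw⟩ := hN (max N N') (le_max_left _ _)
  obtain ⟨w', hw'⟩ := hN' (max N N') (le_max_right _ _)
  have h : y - z = (X ^ m : k⟦X⟧) • (w' - w) := by
    rw [smul_sub, ← hw, ← hw', sub_sub_sub_cancel_left]
  rw [h, map_smul]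
  exact ⟨_, rfl⟩

end HTendsto

section Uniqueness

variable {k A : Type u} [Field k] [Ring A] [Algebra k⟦X⟧ A] {H : TopHopfAlgebra k A}
variable {V Ω : Type u} [AddCommGroup V] [Module k⟦X⟧ V] [Module A V] [IsScalarTower k⟦X⟧ A V]
  [AddCommGroup Ω] [Module k⟦X⟧ Ω]

theorem IsTwistedAction.unique [Module.Free k⟦X⟧ (Ω ⊗[k⟦X⟧] Module.Dual k⟦X⟧ V)]
    {θ : A →ₐ[k⟦X⟧] k⟦X⟧}
    {ρ ρ' : Aᵐᵒᵖ →ₐ[k⟦X⟧] Module.End k⟦X⟧ (Ω ⊗[k⟦X⟧] Module.Dual k⟦X⟧ V)}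
    (h : IsTwistedAction H θ ρ) (h' : IsTwistedAction H θ ρ') : ρ = ρ' := by
  refine AlgHom.ext fun u => TensorProduct.ext' fun ω f => ?_
  choose t ht using fun n => exists_approxAt n (H.Δ u.unop)
  exact (h u.unop ω f t ht).unique (h' u.unop ω f t ht)

end Uniqueness

namespace TopHopfAlgebra

variable {k A : Type u} [Field k] [Ring A] [Algebra k⟦X⟧ A] {H : TopHopfAlgebra k A}
variable {ι : Type} [Fintype ι] [DecidableEq ι]
variable {V : Type u} [AddCommGroup V] [Module k⟦X⟧ V] [Module A V] [IsScalarTower k⟦X⟧ A V]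

/-- The twist of the trivial module by `V` is `V`. -/
theorem nonempty_twist_augModule_iso (b : Module.Basis ι k⟦X⟧ V) :
    Nonempty ((twistFunctor (twist (H.isContinuousRep_matrixRep b))).obj
      (augModule H.ε.toRingHom) ≅ ModuleCat.of A V) := by
  let T := twist (H.isContinuousRep_matrixRep b)
  let e : (ι → k⟦X⟧) ≃ₗ[k⟦X⟧] V := b.equivFun.symm
  let f : Twisted T (augModule H.ε.toRingHom) → (ι → k⟦X⟧) := fun y => y.coord
  -- Entries of T(u) act on K through ε, and `counit_twist` gives back the matrix of u on V.
  have hf : ∀ (u : A) y, f (u • y) = (matrixRep A b u).mulVec (f y) := fun u y => funext fun i => by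
    refine Finset.sum_congr rfl fun j _ => ?_
    change H.ε (T u i j) * f y j = _
    rw [counit_twist (H.isContinuousForm_algHom _)]
  refine ⟨LinearEquiv.toModuleIso
    { toFun := fun y => e (f y)
      invFun := fun v => Twisted.mk T (e.symm v)
      left_inv := fun y => e.symm_apply_apply (f y)
      right_inv := fun v => e.apply_symm_apply v
      map_add' := fun y z => map_add e (f y) (f z)
      map_smul' := fun u y => ?_ }⟩
  change e (f (u • y)) = u • e (f y)
  rw [hf]
  simp only [e, Module.Basis.equivFun_symm_apply, Matrix.mulVec, dotProduct, Finset.smul_sum,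
    Finset.sum_smul]
  rw [Finset.sum_comm]
  refine Finset.sum_congr rfl fun j _ => ?_
  rw [smul_algebra_smul_comm, ← sum_matrixRep_smul, Finset.smul_sum]
  refine Finset.sum_congr rfl fun i _ => ?_
  rw [smul_smul, mul_comm]

variable {r : A →ₐ[k⟦X⟧] Matrix ι ι k⟦X⟧}

/-- The matrices of the right action on `V*` twisted by the character `θ`. -/
noncomputable def twistedMatrix (hr : H.IsContinuousRep r) (θ : A →ₐ[k⟦X⟧] k⟦X⟧) :
    Aᵐᵒᵖ →ₐ[k⟦X⟧] Matrix ι ι k⟦X⟧ where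
  toFun u := Matrix.of fun j m => θ (twist hr u.unop m j)
  map_one' := by
    refine Matrix.ext fun j m => ?_
    simp [Matrix.one_apply, apply_ite θ, eq_comm]
  map_mul' u v := by
    refine Matrix.ext fun j m => ?_
    simp [Matrix.mul_apply, mul_comm]
  map_zero' := by
    refine Matrix.ext fun j m => ?_
    simp
  map_add' u v := by
    refine Matrix.ext fun j m => ?_
    simp
  commutes' c := by
    refine Matrix.ext fun j m => ?_
    rw [Matrix.of_apply, MulOpposite.algebraMap_apply, unop_op, twist_apply,
      Algebra.algebraMap_eq_smul_one, map_smul, (hr m j).contract_one]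
    simp [Matrix.algebraMap_matrix_apply, Matrix.one_apply, eq_comm, apply_ite θ]

theorem twistedMatrix_apply (hr : H.IsContinuousRep r) (θ : A →ₐ[k⟦X⟧] k⟦X⟧) (u : A) (j m : ι) :
    twistedMatrix hr θ (op u) j m = θ (H.contract (coeffForm r.toLinearMap m j) u) := rfl

variable (Ω : Type u) [AddCommGroup Ω] [Module k⟦X⟧ Ω]

/-- The right action on `Ω ⊗ V*` twisted by the character `θ`. -/
noncomputable def twistedAction (b : Module.Basis ι k⟦X⟧ V) (hr : H.IsContinuousRep r)
    (θ : A →ₐ[k⟦X⟧] k⟦X⟧) :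
    Aᵐᵒᵖ →ₐ[k⟦X⟧] Module.End k⟦X⟧ (Ω ⊗[k⟦X⟧] Module.Dual k⟦X⟧ V) :=
  (Module.End.lTensorAlgHom k⟦X⟧ _ Ω).comp
    ((Matrix.toLinAlgEquiv b.dualBasis).toAlgHom.comp (twistedMatrix hr θ))

variable {Ω}

theorem twistedAction_tmul_dualBasis (b : Module.Basis ι k⟦X⟧ V) (hr : H.IsContinuousRep r)
    (θ : A →ₐ[k⟦X⟧] k⟦X⟧) (u : A) (ω : Ω) (m : ι) :
    twistedAction Ω b hr θ (op u) (ω ⊗ₜ b.dualBasis m) =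
      ∑ j, θ (H.contract (coeffForm r.toLinearMap m j) u) • (ω ⊗ₜ b.dualBasis j) := by
  change ω ⊗ₜ (Matrix.toLinAlgEquiv b.dualBasis (twistedMatrix hr θ (op u)) (b.dualBasis m)) = _
  rw [Matrix.toLinAlgEquiv_self, TensorProduct.tmul_sum]
  simp only [TensorProduct.tmul_smul, twistedMatrix_apply]

theorem twistedAction_tmul (b : Module.Basis ι k⟦X⟧ V) (hr : H.IsContinuousRep r)
    (θ : A →ₐ[k⟦X⟧] k⟦X⟧) (u : A) (ω : Ω) (f : Module.Dual k⟦X⟧ V) :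
    twistedAction Ω b hr θ (op u) (ω ⊗ₜ f) =
      ∑ m, ∑ j, (f (b m) * θ (H.contract (coeffForm r.toLinearMap m j) u)) •
        (ω ⊗ₜ[k⟦X⟧] b.dualBasis j) := by
  have hf : f = ∑ m, f (b m) • b.dualBasis m := (b.sum_dual_apply_smul_coord f).symm.trans (by simp)
  conv_lhs => rw [hf, TensorProduct.tmul_sum, map_sum]
  refine Finset.sum_congr rfl fun m _ => ?_
  rw [TensorProduct.tmul_smul, map_smul, twistedAction_tmul_dualBasis, Finset.smul_sum]
  simp only [smul_smul]

/-- Every finite stage of the limit is expressed by slices along the coefficients of r = (matrix of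
S²), so that the limit is given by the contractions. -/
theorem twistSum_eq (b : Module.Basis ι k⟦X⟧ V)
    (hs : ∀ a i j, r a i j = matrixRep A b (H.S (H.S a)) i j)
    (θ : A →ₐ[k⟦X⟧] k⟦X⟧) (ω : Ω) (f : Module.Dual k⟦X⟧ V) (t : A ⊗[k⟦X⟧] A) :
    twistSum H θ ω f t = ∑ m, ∑ j, (f (b m) * θ (slice (coeffForm r.toLinearMap m j) t)) •
        (ω ⊗ₜ[k⟦X⟧] b.dualBasis j) := by
  induction t with
  | zero => simp
  | add x y hx hy => simp only [map_add, hx, hy, mul_add, add_smul, Finset.sum_add_distrib]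
  | tmul x y =>
    have h1 : dualAct f (H.S (H.S y)) = ∑ m, ∑ j, (f (b m) * r y m j) • b.dualBasis j := by
      refine b.ext fun l => ?_
      have h2 : dualAct f (H.S (H.S y)) (b l) = f (H.S (H.S y) • b l) := rfl
      rw [h2, ← sum_matrixRep_smul, map_sum, LinearMap.sum_apply]
      refine Finset.sum_congr rfl fun m _ => ?_
      rw [LinearMap.sum_apply, Finset.sum_eq_single l]
      · simp [hs, mul_comm]
      · intro j _ hj
        simp [hj.symm]
      · simp
    change θ.toLinearMap.smulRight ω x ⊗ₜ dualAct f (H.S (H.S y)) = _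
    rw [h1, TensorProduct.tmul_sum]
    refine Finset.sum_congr rfl fun m _ => ?_
    rw [TensorProduct.tmul_sum]
    refine Finset.sum_congr rfl fun j _ => ?_
    rw [TensorProduct.tmul_smul, slice_tmul, map_smul, LinearMap.smulRight_apply,
      ← TensorProduct.smul_tmul', smul_smul, smul_eq_mul, mul_assoc]
    rfl

theorem isTwistedAction_twistedAction (b : Module.Basis ι k⟦X⟧ V) (hr : H.IsContinuousRep r)
    (hs : ∀ a i j, r a i j = matrixRep A b (H.S (H.S a)) i j) (θ : A →ₐ[k⟦X⟧] k⟦X⟧) :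
    IsTwistedAction H θ (twistedAction Ω b hr θ) := by
  intro u ω f t ht M
  obtain ⟨n, hn⟩ := H.isContinuousForm_algHom θ M
  choose N hN using fun m j => (hr m j).contract_spec n
  refine ⟨∑ m, ∑ j, N m j, fun n' hn' => ?_⟩
  have h : ∀ m j, X ^ M ∣ θ (slice (coeffForm r.toLinearMap m j) (t n')) -
      θ (H.contract (coeffForm r.toLinearMap m j) u) := fun m j => by
    rw [← map_sub]
    have h1 := Finset.single_le_sum (f := N m) (fun _ _ => Nat.zero_le _) (Finset.mem_univ j)
    have h2 := Finset.single_le_sum (f := fun m => ∑ j, N m j) (fun _ _ => Nat.zero_le _)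
      (Finset.mem_univ m)
    exact hn _ (hN m j n' (h1.trans (h2.trans hn')) u _ (ht n'))
  choose c hc using h
  refine ⟨∑ m, ∑ j, (f (b m) * c m j) • (ω ⊗ₜ[k⟦X⟧] b.dualBasis j), ?_⟩
  simp only [twistSum_eq b hs, twistedAction_tmul, ← Finset.sum_sub_distrib, ← sub_smul, ← mul_sub,
    hc, Finset.smul_sum, smul_smul]
  simp only [mul_left_comm]

/-- The twist of a module on which `A` acts through the character `θ`. -/
theorem nonempty_opTwist_iso_repModule (b : Module.Basis ι k⟦X⟧ V) (hr : H.IsContinuousRep r)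
    (θ : A →ₐ[k⟦X⟧] k⟦X⟧) (M : ModuleCat.{u} Aᵐᵒᵖ)
    (hM : ∀ (u : A) (m : M), op u • m = algebraMap k⟦X⟧ Aᵐᵒᵖ (θ u) • m) :
    Nonempty ((twistFunctor (opTwist (twist hr))).obj M ≅
      repModule (twistedAction (asBase k⟦X⟧ M) b hr θ)) := by
  let U := opTwist (twist hr)
  let e : (ι → asBase k⟦X⟧ M) ≃ₗ[k⟦X⟧] asBase k⟦X⟧ M ⊗[k⟦X⟧] Module.Dual k⟦X⟧ V :=
    (Finsupp.linearEquivFunOnFinite k⟦X⟧ _ ι).symm.trans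
      (TensorProduct.equivFinsuppOfBasisRight b.dualBasis).symm
  have he : ∀ y, e y = ∑ i, y i ⊗ₜ b.dualBasis i := fun y => by
    change (TensorProduct.equivFinsuppOfBasisRight b.dualBasis).symm _ = _
    rw [TensorProduct.equivFinsuppOfBasisRight_symm_apply, Finsupp.sum_fintype _ _ (by simp)]
    rfl
  let f : Twisted U M → (ι → asBase k⟦X⟧ M) := fun y => y.coord
  have hf : ∀ (u : A) y j, f (op u • y) j =
      ∑ m, θ (H.contract (coeffForm r.toLinearMap m j) u) • f y m := fun u y j =>
    Finset.sum_congr rfl fun m _ => hM (twist hr u m j) (y.coord m)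
  let g : Twisted U M ≃ₗ[Aᵐᵒᵖ] repModule (twistedAction (asBase k⟦X⟧ M) b hr θ) :=
    { toFun := fun y => e (f y)
      invFun := fun v => Twisted.mk U (e.symm v)
      left_inv := fun y => e.symm_apply_apply (f y)
      right_inv := fun v => e.apply_symm_apply v
      map_add' := fun y z => map_add e (f y) (f z)
      map_smul' := fun u y => by
        change e (f (op u.unop • y)) = twistedAction (asBase k⟦X⟧ M) b hr θ (op u.unop) (e (f y))
        simp only [he, map_sum, twistedAction_tmul_dualBasis, hf, TensorProduct.sum_tmul]
        rw [Finset.sum_comm]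
        rfl }
  exact ⟨g.toModuleIso⟩

end TopHopfAlgebra

/-! ### Assembly of the duality theorem -/

theorem mainTheorem10
    {k A A₀ : Type u} [Field k] [CharZero k] [Ring A] [Algebra k⟦X⟧ A] [Ring A₀] [Algebra k A₀]
    [IsNoetherianRing A₀] [HasDerivedCategory.{w} (ModuleCat.{u} Aᵐᵒᵖ)]
    (H : TopHopfAlgebra k A)
    (π : A →+* A₀) (hπ : IsDeformation (k := k) π)
    (ε₀ : A₀ →ₐ[k] k) (hε₀ : ∀ a : A, ε₀ (π a) = PowerSeries.constantCoeff (H.ε a))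
    (d : ℕ)
    (hvanish : ∀ i : ℕ, i ≠ d →
      Subsingleton (extToRing A₀ i (augModule ε₀.toRingHom)))
    (hone : Nonempty (asBase k (extToRing A₀ d (augModule ε₀.toRingHom)) ≃ₗ[k] k))
    (V : Type u) [AddCommGroup V] [Module k⟦X⟧ V] [Module A V] [IsScalarTower k⟦X⟧ A V]
    [Module.Free k⟦X⟧ V] [Module.Finite k⟦X⟧ V] :
    ∃ θ : A →ₐ[k⟦X⟧] k⟦X⟧,
      Nonempty (asBase k⟦X⟧ (extToRing A d (augModule H.ε.toRingHom)) ≃ₗ[k⟦X⟧] k⟦X⟧) ∧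
      (∀ (u : A) (ω : extToRing A d (augModule H.ε.toRingHom)),
        op u • ω = algebraMap k⟦X⟧ Aᵐᵒᵖ (θ u) • ω) ∧
      (∃! ρ : Aᵐᵒᵖ →ₐ[k⟦X⟧] Module.End k⟦X⟧
          (asBase k⟦X⟧ (extToRing A d (augModule H.ε.toRingHom)) ⊗[k⟦X⟧] Module.Dual k⟦X⟧ V),
        IsTwistedAction H θ ρ) ∧
      ∀ ρ : Aᵐᵒᵖ →ₐ[k⟦X⟧] Module.End k⟦X⟧
          (asBase k⟦X⟧ (extToRing A d (augModule H.ε.toRingHom)) ⊗[k⟦X⟧] Module.Dual k⟦X⟧ V),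
        IsTwistedAction H θ ρ →
        ∀ P : ProjectiveResolution (ModuleCat.of A V),
          Nonempty (dualObj.{u, w} P ≅
            (DerivedCategory.singleFunctor (ModuleCat.{u} Aᵐᵒᵖ) (d : ℤ)).obj (repModule ρ)) := by
  let Ω := extToRing A d (augModule H.ε.toRingHom)
  obtain ⟨e⟩ := nonempty_extToRing_equiv_of_reduction H hπ ε₀ hε₀ d hvanish hone
  obtain ⟨θ, hθ⟩ := exists_character e
  have : Module.Free k⟦X⟧ (asBase k⟦X⟧ Ω) := Module.Free.of_equiv e.symm
  let b := Module.finBasis k⟦X⟧ V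
  have hε := H.isContinuousForm_algHom H.ε
  have hr := H.isContinuousRep_matrixRep b
  have hr' := hr.dualRep hε
  have hr'' := hr'.dualRep hε
  let ρ := TopHopfAlgebra.twistedAction (asBase k⟦X⟧ Ω) b hr'' θ
  -- The two transpositions in the double dual cancel, so its matrix at a is by definition that of
  -- S²(a) on V.
  have hρ : IsTwistedAction H θ ρ :=
    TopHopfAlgebra.isTwistedAction_twistedAction b hr'' (fun _ _ _ => rfl) θ
  refine ⟨θ, ⟨e⟩, hθ, ⟨ρ, hρ, fun ρ' hρ' => hρ'.unique hρ⟩, fun ρ' hρ' P => ?_⟩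
  -- By uniqueness, only the action constructed from the basis has to be treated.
  obtain rfl : ρ = ρ' := hρ.unique hρ'
  obtain ⟨eV⟩ := TopHopfAlgebra.nonempty_twist_augModule_iso (H := H) b
  obtain ⟨eΩ⟩ := TopHopfAlgebra.nonempty_opTwist_iso_repModule b hr'' θ Ω hθ
  let U := opTwist (TopHopfAlgebra.twist hr'')
  -- V is the twist of the trivial module, so each Ext^i(V, A) is the twist of Ext^i(K, A): zero for
  -- i ≠ d, and the twisted module in degree d.
  let ext (i : ℕ) : (homComplex P.complex).homology i ≅
      (twistFunctor U).obj (extToRing A i (augModule H.ε.toRingHom)) :=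
    (extToRingIso P i).symm ≪≫ (((homToRing A).rightOp.leftDerived i).mapIso eV).unop ≪≫
      extToRingTwistIso (TopHopfAlgebra.isDualTwist hε hr) (TopHopfAlgebra.isDualTwist hε hr') i
  refine nonempty_iso_singleFunctor (homComplex P.complex) d (fun i hi => ?_) _ (ext d ≪≫ eΩ)
  have := subsingleton_extToRing_of_reduction H hπ ε₀ hε₀ i (hvanish i hi)
  have : Subsingleton ((twistFunctor U).obj (extToRing A i (augModule H.ε.toRingHom))) :=
    inferInstanceAs (Subsingleton (_ → extToRing A i (augModule H.ε.toRingHom)))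
  exact (ModuleCat.isZero_of_subsingleton _).of_iso (ext i)
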